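/- Let $k\ge 3$ be an integer, let $\delta>0$ be a fixed real number, and let $p=p(N)\in[0,1]$ ($N\in\mathbb N$) satisfy $N^{-1}\log N\ll p^{k/2}\ll 1$ as $N\to\infty$, where $f\ll g$ means $f=o(g)$. Let $[N]_p$ denote the random subset of $\{1,\dots,N\}$ that contains every element independently with probability $p$, and let $X$ be the number of $k$-term arithmetic progressions $(a,a+b,\dots,a+(k-1)b)$, $b>0$, all of whose terms lie in $[N]_p$. Then $$\lim_{N\to\infty}\frac{-\log \mathbb P\big(X\ge(1+\delta)\,\mathbb E[X]\big)}{N\,p^{k/2}\,\log(1/p)}=\sqrt{\delta}.$$ -/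

import Mathlib

open Filter Topology Asymptotics MeasureTheory ProbabilityTheory

/-- The number of `k`-term arithmetic progressions `(a, a + b, …, a + (k - 1) b)` with positive
common difference `b` all of whose terms lie in `S`; a progression is recorded by the pair
`(a, b)`. This is used for `k ≥ 2` and finite `S`, where the set of such pairs is finite and the
pair determines and is determined by the progression. -/
noncomputable def apCount (k : ℕ) (S : Set ℕ) : ℕ :=
  {ab : ℕ × ℕ | 0 < ab.2 ∧ ∀ i < k, ab.1 + i * ab.2 ∈ S}.ncard

/-- The law of the random subset `[N]_p` of `{1, …, N}`, which contains every element of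
`{1, …, N}` independently with probability `p`. -/
noncomputable def randomSubset (N : ℕ) (p : unitInterval) : Measure (Set ℕ) :=
  setBernoulli (Set.Icc 1 N) p

/-- The expected number of `k`-term arithmetic progressions in `[N]_p`. -/
noncomputable def expectedAP (k N : ℕ) (p : unitInterval) : ℝ :=
  ∫ S, (apCount k S : ℝ) ∂(randomSubset N p)

/-- The upper tail probability `P(X ≥ (1 + δ) E[X])`, where `X` is the number of `k`-term
arithmetic progressions in `[N]_p`. -/
noncomputable def upperTailAP (k N : ℕ) (p : unitInterval) (δ : ℝ) : ℝ :=
  (randomSubset N p).real {S | (apCount k S : ℝ) ≥ (1 + δ) * expectedAP k N p}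

/-! Write `n = N p^(k/2)` and `L = log (1/p)`, so that `E[X]` is asymptotic to `n^2 / (2(k-1))`.
Among sets of `m` integers an interval asymptotically maximises the number of progressions, about
`m^2 / (2(k-1))` (`edgeCount_ap_le`, `le_card_apEdges`). To add `δ E[X]` progressions by planting a
set, about `√δ n` elements are therefore needed, at cost `p^(√δ n) = exp (-√δ n L)`. Planting an
interval of this length bounds the tail from below (`le_upperTail`, `le_upperTailAP`).

For the matching upper bound, take a moment of order `l` proportional to `n L`, truncated to the
event that no small subset of the random set raises the conditional mean above `(1 + δ - ε) E[X]`.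
Markov's inequality on this event gives `((1 + δ - ε) / (1 + δ))^l`, which is small enough
(`upperTail_le`). Off this event the random set contains a small set with large conditional mean.
Deleting elements of little influence turns it into a core (`exists_core`). Since partially planted
progressions contribute little, every element of a core lies in many progressions inside the core,
and a core has at least about `√δ n` elements.

It remains to union bound over cores. There are about `p^(-km/2)` sets of size `m` near `n`, too
many against `p^m`, but only `p^(-o(m))` of them are cores. By the second moment method a core
contains a sparse random-like subset, its fingerprint, with which all its other elements complete
many progressions, and few integers have that property (`exists_fingerprint`,
`card_linkCount_ge_le`, `card_largeDegree_le`). The number of possible sizes costs a factor `N + 1`,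
negligible because `log N = o(n)`. -/

/-! ### Moments, cores and planting in a random vertex subset of a hypergraph. -/

section RandomSubset

variable {α β : Type*} [DecidableEq α]

/-- The probability that the random subset of `V` containing each element independently with
probability `p` equals `S`. -/
def bernoulliWeight (p : ℝ) (V S : Finset α) : ℝ :=
  p ^ S.card * (1 - p) ^ (V \ S).card

/-- The number of hyperedges contained in `S`. -/
def edgeCount (E : Finset β) (T : β → Finset α) (S : Finset α) : ℕ :=
  {e ∈ E | T e ⊆ S}.card

/-- The expected number of hyperedges in the random set, conditioned on containing `I`. -/
def condExpect (p : ℝ) (E : Finset β) (T : β → Finset α) (I : Finset α) : ℝ :=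
  ∑ e ∈ E, p ^ (T e \ I).card

lemma bernoulliWeight_nonneg {p : ℝ} (h0 : 0 ≤ p) (h1 : p ≤ 1) (V S : Finset α) :
    0 ≤ bernoulliWeight p V S :=
  mul_nonneg (pow_nonneg h0 _) (pow_nonneg (by linarith) _)

/-- The random set contains `A` with probability `p ^ |A|`. -/
lemma sum_bernoulliWeight_superset (p : ℝ) {V A : Finset α} (hA : A ⊆ V) :
    ∑ S ∈ V.powerset with A ⊆ S, bernoulliWeight p V S = p ^ A.card := by
  have h := Finset.sum_pow_mul_eq_add_pow p (1 - p) (V \ A)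
  rw [add_sub_cancel, one_pow] at h
  rw [← mul_one (p ^ A.card), ← h, Finset.mul_sum]
  refine Finset.sum_bij' (fun S _ => S \ A) (fun S _ => S ∪ A) ?_ ?_ ?_ ?_ ?_
  · intro S hS
    simp only [Finset.mem_filter, Finset.mem_powerset] at hS ⊢
    exact Finset.sdiff_subset_sdiff hS.1 subset_rfl
  · intro S hS
    simp only [Finset.mem_filter, Finset.mem_powerset] at hS ⊢
    exact ⟨Finset.union_subset (hS.trans Finset.sdiff_subset) hA, Finset.subset_union_right⟩
  · intro S hS
    simp only [Finset.mem_filter, Finset.mem_powerset] at hS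
    exact Finset.sdiff_union_of_subset hS.2
  · intro S hS
    simp only [Finset.mem_powerset] at hS
    grind
  · intro S hS
    simp only [Finset.mem_filter, Finset.mem_powerset] at hS
    have h1 : S.card = A.card + (S \ A).card := by
      rw [Finset.card_sdiff_of_subset hS.2]
      have := Finset.card_le_card hS.2
      omega
    have h2 : (V \ S).card = (V \ A).card - (S \ A).card := by
      rw [← Finset.card_sdiff_of_subset (Finset.sdiff_subset_sdiff hS.1 subset_rfl)]
      congr 1
      grind
    rw [bernoulliWeight, h1, h2, pow_add, mul_assoc]

lemma sum_mul_edgeCount (V : Finset α) (E : Finset β) (T : β → Finset α) (P : Finset α → Prop)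
    [DecidablePred P] (f : Finset α → ℝ) :
    ∑ S ∈ V.powerset with P S, f S * edgeCount E T S =
      ∑ e ∈ E, ∑ S ∈ V.powerset with (T e ⊆ S ∧ P S), f S := by
  have h1 : ∀ S : Finset α, (edgeCount E T S : ℝ) = ∑ e ∈ E, if T e ⊆ S then 1 else 0 := by
    intro S
    rw [edgeCount, Finset.sum_boole]
  simp_rw [h1, Finset.mul_sum]
  rw [Finset.sum_comm]
  refine Finset.sum_congr rfl fun e _ => ?_
  rw [Finset.sum_filter, Finset.sum_filter]
  refine Finset.sum_congr rfl fun S _ => ?_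
  by_cases h1 : T e ⊆ S <;> by_cases h2 : P S <;> simp [h1, h2]

lemma sum_pow_card_union (p : ℝ) (E : Finset β) (T : β → Finset α) (I : Finset α) :
    ∑ e ∈ E, p ^ (T e ∪ I).card = p ^ I.card * condExpect p E T I := by
  rw [condExpect, Finset.mul_sum]
  refine Finset.sum_congr rfl fun e _ => ?_
  rw [← pow_add, Finset.union_comm, ← Finset.card_union_of_disjoint Finset.disjoint_sdiff,
    Finset.union_sdiff_self_eq_union]

/-- The expectation of the edge count restricted to the event of containing `I`. -/
lemma sum_bernoulliWeight_edgeCount (p : ℝ) {V I : Finset α} (hI : I ⊆ V) (E : Finset β)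
    (T : β → Finset α) (hT : ∀ e ∈ E, T e ⊆ V) :
    ∑ S ∈ V.powerset with I ⊆ S, bernoulliWeight p V S * edgeCount E T S =
      p ^ I.card * condExpect p E T I := by
  rw [sum_mul_edgeCount, ← sum_pow_card_union]
  refine Finset.sum_congr rfl fun e he => ?_
  rw [← sum_bernoulliWeight_superset p (Finset.union_subset (hT e he) hI)]
  simp_rw [Finset.union_subset_iff]

open Classical in
/-- High moments of the edge count, truncated to the event that no small subset raises the
conditional expectation beyond `c`. -/
lemma sum_bernoulliWeight_edgeCount_pow_le {p : ℝ} (h0 : 0 ≤ p) (h1 : p ≤ 1) {V : Finset α}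
    {E : Finset β} {T : β → Finset α} (hT : ∀ e ∈ E, T e ⊆ V) {k M : ℕ}
    (hk : ∀ e ∈ E, (T e).card ≤ k) {c : ℝ} (hc : 0 ≤ c) (l : ℕ) :
    ∀ I ⊆ V, I.card + k * l ≤ M →
      ∑ S ∈ V.powerset with
        (I ⊆ S ∧ ∀ J ⊆ S, J.card ≤ M → condExpect p E T J ≤ c),
        bernoulliWeight p V S * (edgeCount E T S : ℝ) ^ l ≤ c ^ l * p ^ I.card := by
  induction l with
  | zero =>
    intro I hI _
    simp only [pow_zero, mul_one, one_mul]
    rw [← sum_bernoulliWeight_superset p hI]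
    refine Finset.sum_le_sum_of_subset_of_nonneg ?_ fun S _ _ => bernoulliWeight_nonneg h0 h1 V S
    intro S hS
    simp only [Finset.mem_filter] at hS ⊢
    exact ⟨hS.1, hS.2.1⟩
  | succ l ih =>
    intro I hI hcard
    by_cases hIc : condExpect p E T I ≤ c
    -- One factor of the power is expanded over edges `e`, and the planted set grows from `I` to `T
    -- e ∪ I`. It gains at most `k` vertices, which the drop from `k * (l + 1)` to `k * l` pays for.
    · simp_rw [pow_succ, ← mul_assoc]
      rw [sum_mul_edgeCount]
      calc ∑ e ∈ E, ∑ S ∈ V.powerset with (T e ⊆ S ∧ (I ⊆ S ∧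
              ∀ J ⊆ S, J.card ≤ M → condExpect p E T J ≤ c)),
              bernoulliWeight p V S * (edgeCount E T S : ℝ) ^ l
          ≤ ∑ e ∈ E, c ^ l * p ^ (T e ∪ I).card := by
            refine Finset.sum_le_sum fun e he => ?_
            have h := ih (T e ∪ I) (Finset.union_subset (hT e he) hI) (by
              have := Finset.card_union_le (T e) I
              have := hk e he
              rw [mul_add] at hcard
              omega)
            simp_rw [Finset.union_subset_iff, and_assoc] at h
            exact h
        _ = c ^ l * (p ^ I.card * condExpect p E T I) := by
            rw [← Finset.mul_sum, sum_pow_card_union]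
        _ ≤ c ^ l * (p ^ I.card * c) := by gcongr
        _ = c ^ l * c * p ^ I.card := by ring
    -- Here `I` itself violates the truncation, so no `S` containing it contributes.
    · rw [Finset.sum_eq_zero]
      · positivity
      · intro S hS
        simp only [Finset.mem_filter] at hS
        exact absurd (hS.2.2 I hS.2.1 (by omega)) hIc

/-- A set with large conditional expectation contains a subset which still has large conditional
expectation and each of whose elements has a large influence. -/
lemma exists_core (p : ℝ) (E : Finset β) (T : β → Finset α) {c τ : ℝ} (hτ : 0 ≤ τ)
    (I : Finset α) (hI : c + I.card * τ < condExpect p E T I) :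
    ∃ J ⊆ I, c < condExpect p E T J ∧
      ∀ i ∈ J, τ ≤ condExpect p E T J - condExpect p E T (J.erase i) := by
  induction I using Finset.strongInduction with
  | H I ih =>
    by_cases h : ∀ i ∈ I, τ ≤ condExpect p E T I - condExpect p E T (I.erase i)
    · exact ⟨I, subset_rfl, lt_of_le_of_lt (le_add_of_nonneg_right (by positivity)) hI, h⟩
    -- Deleting an element of influence below `τ` loses less than the `τ` released by the term
    -- `I.card * τ`.
    · push Not at h
      obtain ⟨i, hi, hlt⟩ := h
      obtain ⟨J, hJ, hJ'⟩ := ih (I.erase i) (Finset.erase_ssubset hi) (by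
        have : (I.card : ℝ) = (I.erase i).card + 1 := by
          rw [← Finset.card_erase_add_one hi]; push_cast; rfl
        rw [this] at hI
        linarith)
      exact ⟨J, hJ.trans (Finset.erase_subset _ _), hJ'⟩

/-- The upper tail of the edge count is bounded by a truncated moment and the probability of
containing a member of a family `C` of sets that covers all small sets with large conditional
expectation. -/
lemma upperTail_le {p : ℝ} (h0 : 0 ≤ p) (h1 : p ≤ 1) {V : Finset α}
    {E : Finset β} {T : β → Finset α} (hT : ∀ e ∈ E, T e ⊆ V) {k l : ℕ}
    (hk : ∀ e ∈ E, (T e).card ≤ k) {c x : ℝ} (hc : 0 ≤ c) (hx : 0 < x) (C : Finset (Finset α))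
    (hCV : ∀ J ∈ C, J ⊆ V)
    (hC : ∀ I ⊆ V, I.card ≤ k * l → c < condExpect p E T I → ∃ J ∈ C, J ⊆ I) :
    ∑ S ∈ V.powerset with x ≤ edgeCount E T S, bernoulliWeight p V S ≤
      (c / x) ^ l + ∑ J ∈ C, p ^ J.card := by
  classical
  have hw := fun S => bernoulliWeight_nonneg h0 h1 V S
  set F : Finset α → Prop := fun S => ∀ J ⊆ S, J.card ≤ k * l → condExpect p E T J ≤ c with hF
  have hmom := sum_bernoulliWeight_edgeCount_pow_le h0 h1 hT (M := k * l) hk hc l ∅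
    (Finset.empty_subset _) (by simp)
  simp only [Finset.empty_subset, true_and, Finset.card_empty, pow_zero, mul_one] at hmom
  -- Markov's inequality for the truncated `l`-th moment.
  have hA : ∑ S ∈ V.powerset with (x ≤ edgeCount E T S ∧ F S), bernoulliWeight p V S ≤
      (c / x) ^ l := by
    rw [div_pow, le_div_iff₀ (by positivity), Finset.sum_mul]
    refine le_trans ?_ hmom
    refine le_trans (Finset.sum_le_sum (g := fun S => bernoulliWeight p V S *
      (edgeCount E T S : ℝ) ^ l) fun S hS => ?_) ?_
    · simp only [Finset.mem_filter] at hS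
      exact mul_le_mul_of_nonneg_left (pow_le_pow_left₀ hx.le hS.2.1 l) (hw S)
    · refine Finset.sum_le_sum_of_subset_of_nonneg ?_
        fun S _ _ => mul_nonneg (hw S) (by positivity)
      intro S hS
      simp only [Finset.mem_filter] at hS ⊢
      exact ⟨hS.1, hS.2.2⟩
  -- Union bound: when the truncation fails, `S` contains a member of `C`.
  have hB : ∑ S ∈ V.powerset with (x ≤ edgeCount E T S ∧ ¬ F S), bernoulliWeight p V S ≤
      ∑ J ∈ C, p ^ J.card := by
    rw [← Finset.sum_congr rfl fun J hJ => sum_bernoulliWeight_superset p (hCV J hJ)]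
    simp_rw [Finset.sum_filter]
    rw [Finset.sum_comm]
    refine Finset.sum_le_sum fun S hS => ?_
    rw [Finset.mem_powerset] at hS
    split_ifs with h
    · simp only [hF, not_forall, not_le] at h
      obtain ⟨-, I, hIS, hIc, hI⟩ := h
      obtain ⟨J, hJC, hJI⟩ := hC I (hIS.trans hS) hIc hI
      have hle := Finset.single_le_sum (f := fun J => if J ⊆ S then bernoulliWeight p V S else 0)
        (fun J _ => by split_ifs <;> simp [hw]) hJC
      simpa [hJI.trans hIS] using hle
    · exact Finset.sum_nonneg fun J _ => by split_ifs <;> simp [hw]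
  have hsplit : ∑ S ∈ V.powerset with x ≤ edgeCount E T S, bernoulliWeight p V S =
      ∑ S ∈ V.powerset with (x ≤ edgeCount E T S ∧ F S), bernoulliWeight p V S +
      ∑ S ∈ V.powerset with (x ≤ edgeCount E T S ∧ ¬ F S), bernoulliWeight p V S := by
    rw [← Finset.sum_filter_add_sum_filter_not (s := {S ∈ V.powerset | x ≤ edgeCount E T S}) F,
      Finset.filter_filter, Finset.filter_filter]
  rw [hsplit]
  exact add_le_add hA hB

/-- A lower bound on the upper tail obtained by planting the set `I`. -/
lemma le_upperTail {p : ℝ} (h0 : 0 ≤ p) (h1 : p ≤ 1) {V I : Finset α} (hI : I ⊆ V)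
    {E : Finset β} {T : β → Finset α} (hT : ∀ e ∈ E, T e ⊆ V) {x : ℝ} (hx : 0 ≤ x) :
    p ^ I.card * (condExpect p E T I - x) ≤
      E.card * ∑ S ∈ V.powerset with x ≤ edgeCount E T S, bernoulliWeight p V S := by
  have hw := fun S => bernoulliWeight_nonneg h0 h1 V S
  rw [mul_sub, ← sum_bernoulliWeight_edgeCount p hI E T hT, ← sum_bernoulliWeight_superset p hI,
    sub_le_iff_le_add, Finset.mul_sum, Finset.sum_mul, Finset.sum_filter, Finset.sum_filter,
    Finset.sum_filter, ← Finset.sum_add_distrib]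
  -- Pointwise, with `X` the edge count: `X·1[I ⊆ S] ≤ |E|·1[X ≥ x] + x·1[I ⊆ S]`.
  refine Finset.sum_le_sum fun S _ => ?_
  have hcard : (edgeCount E T S : ℝ) ≤ E.card := by
    exact_mod_cast Finset.card_filter_le _ _
  have := hw S
  split_ifs with h2 h3 h4
  · nlinarith
  · push Not at h3
    nlinarith
  · simp; positivity
  · simp

end RandomSubset

/-! ### Probabilities and integrals under `setBernoulli` as finite weighted sums. -/

section Bridge

lemma setBernoulli_real_eq_sum {ι : Type*} [Countable ι] [DecidableEq ι] (V : Finset ι)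
    (p : unitInterval) (A : Set (Set ι)) [DecidablePred fun S : Finset ι => (S : Set ι) ∈ A] :
    (setBernoulli (V : Set ι) p).real A =
      ∑ S ∈ V.powerset.filter (fun S : Finset ι => (S : Set ι) ∈ A), bernoulliWeight p V S := by
  have hA : {s ∈ A | s ⊆ (V : Set ι)} =
      ⋃ S ∈ V.powerset.filter (fun S : Finset ι => (S : Set ι) ∈ A), {(S : Set ι)} := by
    ext s
    simp only [Set.mem_iUnion, Set.mem_singleton_iff, Finset.mem_filter, Finset.mem_powerset,
      exists_prop]
    constructor
    · rintro ⟨h1, h2⟩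
      refine ⟨(V.finite_toSet.subset h2).toFinset, ⟨?_, ?_⟩, ?_⟩
      · intro x hx
        simp only [Set.Finite.mem_toFinset] at hx
        exact h2 hx
      · simpa using h1
      · simp
    · rintro ⟨S, ⟨h1, h2⟩, rfl⟩
      exact ⟨h2, by exact_mod_cast h1⟩
  rw [measureReal_def, setBernoulli_apply_eq_apply_subsets, ← measureReal_def, hA,
    measureReal_biUnion_finset]
  · refine Finset.sum_congr rfl fun S hS => ?_
    simp only [Finset.mem_filter, Finset.mem_powerset] at hS
    rw [setBernoulli_real_singleton p (by exact_mod_cast hS.1) V.finite_toSet,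
      ← Finset.coe_sdiff, Set.ncard_coe_finset, Set.ncard_coe_finset, bernoulliWeight]
  · intro S _ S' _ hne
    simp [Function.onFun, hne]
  · intro S _
    exact MeasurableSet.singleton _

lemma integral_setBernoulli_eq_sum {ι : Type*} [Countable ι] [DecidableEq ι] (V : Finset ι)
    (p : unitInterval) (f : Set ι → ℝ) :
    ∫ S, f S ∂(setBernoulli (V : Set ι) p) =
      ∑ S ∈ V.powerset, bernoulliWeight p V S * f (S : Set ι) := by
  classical
  set F : Finset (Set ι) := Finset.map ⟨fun S : Finset ι => (S : Set ι), Finset.coe_injective⟩ V.powerset with hF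
  have h1 : (setBernoulli (V : Set ι) p).restrict (F : Set (Set ι)) = setBernoulli (V : Set ι) p := by
    refine Measure.restrict_eq_self_of_ae_mem ?_
    filter_upwards [setBernoulli_ae_subset] with s hs
    simp only [hF, Finset.coe_map, Function.Embedding.coeFn_mk, Set.mem_image, Finset.mem_coe,
      Finset.mem_powerset]
    refine ⟨(V.finite_toSet.subset hs).toFinset, ?_, by simp⟩
    intro x hx
    simp only [Set.Finite.mem_toFinset] at hx
    exact hs hx
  rw [← h1, setIntegral_finset _ IntegrableOn.finset, hF, Finset.sum_map]
  refine Finset.sum_congr rfl fun S hS => ?_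
  rw [Finset.mem_powerset] at hS
  simp only [Function.Embedding.coeFn_mk, smul_eq_mul]
  rw [setBernoulli_real_singleton p (by exact_mod_cast hS) V.finite_toSet,
      ← Finset.coe_sdiff, Set.ncard_coe_finset, Set.ncard_coe_finset, bernoulliWeight]

end Bridge

/-! ### Arithmetic progressions as a `k`-uniform hypergraph on `{1, …, N}`. -/

section Progressions

/-- The pairs `(a, b)` coding the `k`-term arithmetic progressions in `{1, …, N}`. -/
def apEdges (k N : ℕ) : Finset (ℕ × ℕ) :=
  {ab ∈ Finset.Icc 1 N ×ˢ Finset.Icc 1 N | ab.1 + (k - 1) * ab.2 ≤ N}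

/-- The terms of the `k`-term arithmetic progression `(a, a + b, …, a + (k - 1) b)`. -/
def apTerms (k : ℕ) (ab : ℕ × ℕ) : Finset ℕ :=
  (Finset.range k).image fun i => ab.1 + i * ab.2

lemma mem_apEdges {k N : ℕ} (hk : 2 ≤ k) {e : ℕ × ℕ} :
    e ∈ apEdges k N ↔ 0 < e.1 ∧ 0 < e.2 ∧ e.1 + (k - 1) * e.2 ≤ N := by
  simp only [apEdges, Finset.mem_filter, Finset.mem_product, Finset.mem_Icc]
  constructor
  · rintro ⟨⟨⟨h1, -⟩, h2, -⟩, h3⟩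
    exact ⟨h1, h2, h3⟩
  · rintro ⟨h1, h2, h3⟩
    have : 1 * e.2 ≤ (k - 1) * e.2 := Nat.mul_le_mul_right _ (by omega)
    exact ⟨⟨⟨h1, by omega⟩, h2, by omega⟩, h3⟩

lemma mem_apTerms {k x : ℕ} {e : ℕ × ℕ} : x ∈ apTerms k e ↔ ∃ i < k, e.1 + i * e.2 = x := by
  simp [apTerms]

lemma apTerms_subset {k N : ℕ} (hk : 2 ≤ k) {e : ℕ × ℕ} (he : e ∈ apEdges k N) :
    apTerms k e ⊆ Finset.Icc 1 N := by
  rw [mem_apEdges hk] at he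
  intro x hx
  obtain ⟨i, hi, rfl⟩ := mem_apTerms.1 hx
  have : i * e.2 ≤ (k - 1) * e.2 := Nat.mul_le_mul_right _ (by omega)
  rw [Finset.mem_Icc]
  omega

lemma card_apTerms {k N : ℕ} (hk : 2 ≤ k) {e : ℕ × ℕ} (he : e ∈ apEdges k N) :
    (apTerms k e).card = k := by
  rw [mem_apEdges hk] at he
  rw [apTerms, Finset.card_image_of_injective, Finset.card_range]
  intro i j hij
  simpa [he.2.1.ne'] using hij

lemma apCount_coe {k N : ℕ} (hk : 2 ≤ k) {S : Finset ℕ} (hS : S ⊆ Finset.Icc 1 N) :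
    apCount k (S : Set ℕ) = edgeCount (apEdges k N) (apTerms k) S := by
  rw [apCount, edgeCount, ← Set.ncard_coe_finset]
  congr 1
  ext e
  simp only [Set.mem_ofPred_eq, Finset.mem_coe, Finset.mem_filter, mem_apEdges hk]
  constructor
  · rintro ⟨h1, h2⟩
    have h3 := Finset.mem_Icc.1 (hS (by simpa using h2 0 (by omega)))
    have h4 := Finset.mem_Icc.1 (hS (by simpa using h2 (k - 1) (by omega)))
    refine ⟨⟨h3.1, h1, h4.2⟩, ?_⟩
    intro x hx
    obtain ⟨i, hi, rfl⟩ := mem_apTerms.1 hx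
    exact h2 i hi
  · rintro ⟨⟨-, h1, -⟩, h2⟩
    exact ⟨h1, fun i hi => h2 (mem_apTerms.2 ⟨i, hi, rfl⟩)⟩

lemma expectedAP_eq {k : ℕ} (hk : 2 ≤ k) (N : ℕ) (p : unitInterval) :
    expectedAP k N p = (apEdges k N).card * (p : ℝ) ^ k := by
  have h := sum_bernoulliWeight_edgeCount p (Finset.empty_subset (Finset.Icc 1 N)) (apEdges k N)
    (apTerms k) (fun e he => apTerms_subset hk he)
  simp only [Finset.empty_subset, Finset.filter_true, Finset.card_empty, pow_zero, one_mul] at h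
  rw [expectedAP, randomSubset, ← Finset.coe_Icc, integral_setBernoulli_eq_sum]
  have h1 : ∀ S ∈ (Finset.Icc 1 N).powerset,
      bernoulliWeight p (Finset.Icc 1 N) S * (apCount k (S : Set ℕ) : ℝ) =
        bernoulliWeight p (Finset.Icc 1 N) S * edgeCount (apEdges k N) (apTerms k) S := by
    intro S hS
    rw [apCount_coe hk (Finset.mem_powerset.1 hS)]
  have h2 : ∀ e ∈ apEdges k N, (p : ℝ) ^ (apTerms k e \ ∅).card = (p : ℝ) ^ k := by
    intro e he
    rw [Finset.sdiff_empty, card_apTerms hk he]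
  rw [Finset.sum_congr rfl h1, h, condExpect, Finset.sum_congr rfl h2]
  simp

lemma upperTailAP_eq {k : ℕ} (hk : 2 ≤ k) (N : ℕ) (p : unitInterval) (δ : ℝ) :
    upperTailAP k N p δ = ∑ S ∈ (Finset.Icc 1 N).powerset with
      (1 + δ) * ((apEdges k N).card * (p : ℝ) ^ k) ≤ edgeCount (apEdges k N) (apTerms k) S,
        bernoulliWeight p (Finset.Icc 1 N) S := by
  classical
  rw [upperTailAP, randomSubset, ← Finset.coe_Icc, setBernoulli_real_eq_sum, expectedAP_eq hk]
  refine Finset.sum_congr ?_ fun S _ => ?_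
  · ext S
    simp only [Finset.mem_filter, Set.mem_ofPred_eq, ge_iff_le]
    refine and_congr_right fun hS => ?_
    rw [apCount_coe hk (Finset.mem_powerset.1 hS)]
  · rfl

end Progressions

/-! ### Conditional expectation compared with degrees and edge counts inside the planted set. -/

section Influence

variable {α β : Type*} [DecidableEq α]

/-- The contribution to the conditional expectation of the hyperedges through `i` that are not
contained in the planted set is small. -/
lemma sum_pow_sdiff_le {p : ℝ} (h0 : 0 ≤ p) (h1 : p ≤ 1) {E : Finset β} {T : β → Finset α}
    {k : ℕ} (hk : ∀ e ∈ E, (T e).card = k) {d₁ d₂ : ℕ}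
    (hd₁ : ∀ x, {e ∈ E | x ∈ T e}.card ≤ d₁)
    (hd₂ : ∀ x y, x ≠ y → {e ∈ E | x ∈ T e ∧ y ∈ T e}.card ≤ d₂) {J : Finset α} {i : α}
    (hi : i ∈ J) :
    ∑ e ∈ E with (i ∈ T e ∧ ¬ T e ⊆ J), p ^ (T e \ J).card ≤
      d₁ * p ^ (k - 1) + d₂ * J.card * p := by
  -- An edge through `i` either meets `J` in `i` alone and has weight `p ^ (k - 1)`, or has a second
  -- vertex `y` in `J`; not being contained in `J`, it then has weight at most `p`.
  have hterm : ∀ e ∈ E, (if i ∈ T e ∧ ¬ T e ⊆ J then p ^ (T e \ J).card else 0) ≤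
      (if i ∈ T e then p ^ (k - 1) else 0) +
        ∑ y ∈ J.erase i, if i ∈ T e ∧ y ∈ T e then p else 0 := by
    intro e he
    have hnn : 0 ≤ ∑ y ∈ J.erase i, if i ∈ T e ∧ y ∈ T e then p else 0 :=
      Finset.sum_nonneg fun y _ => by split_ifs <;> simp [h0]
    by_cases hie : i ∈ T e
    swap
    · simp only [hie, false_and, if_false]
      simp
    by_cases hJ : T e ⊆ J
    · simp only [hJ, not_true, and_false, if_false]
      exact add_nonneg (by split_ifs <;> positivity) hnn
    simp only [hie, hJ, not_false_eq_true, and_self, if_true, true_and]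
    simp only [hie, true_and] at hnn
    by_cases hy : ∃ y ∈ J.erase i, y ∈ T e
    · obtain ⟨y, hyJ, hye⟩ := hy
      have h2 := Finset.single_le_sum (f := fun y => if y ∈ T e then p else 0)
        (fun y _ => by split_ifs <;> simp [h0]) hyJ
      simp only [hye, if_true] at h2
      have h3 : p ^ (T e \ J).card ≤ p ^ 1 := by
        refine pow_le_pow_of_le_one h0 h1 ?_
        rw [Nat.one_le_iff_ne_zero, Ne, Finset.card_eq_zero, Finset.sdiff_eq_empty_iff_subset]
        exact hJ
      rw [pow_one] at h3
      have : 0 ≤ p ^ (k - 1) := pow_nonneg h0 _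
      linarith
    · push Not at hy
      have : T e \ J = (T e).erase i := by
        ext x
        simp only [Finset.mem_sdiff, Finset.mem_erase]
        constructor
        · rintro ⟨h2, h3⟩
          exact ⟨fun h => h3 (h ▸ hi), h2⟩
        · rintro ⟨h2, h3⟩
          exact ⟨h3, fun h => hy x (Finset.mem_erase.2 ⟨h2, h⟩) h3⟩
      rw [this, Finset.card_erase_of_mem hie, hk e he]
      linarith
  rw [Finset.sum_filter]
  refine (Finset.sum_le_sum hterm).trans ?_
  rw [Finset.sum_add_distrib, Finset.sum_comm]
  have hp : 0 ≤ p ^ (k - 1) := pow_nonneg h0 _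
  refine add_le_add ?_ ?_
  · rw [← Finset.sum_filter, Finset.sum_const, nsmul_eq_mul]
    exact mul_le_mul_of_nonneg_right (by exact_mod_cast hd₁ i) hp
  · calc ∑ y ∈ J.erase i, ∑ e ∈ E, (if i ∈ T e ∧ y ∈ T e then p else 0)
        ≤ ∑ y ∈ J.erase i, (d₂ : ℝ) * p := by
          refine Finset.sum_le_sum fun y hy => ?_
          rw [← Finset.sum_filter, Finset.sum_const, nsmul_eq_mul]
          exact mul_le_mul_of_nonneg_right
            (by exact_mod_cast hd₂ i y (Finset.ne_of_mem_erase hy).symm) h0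
      _ ≤ d₂ * J.card * p := by
          rw [Finset.sum_const, nsmul_eq_mul]
          have : ((J.erase i).card : ℝ) ≤ J.card := by
            exact_mod_cast Finset.card_le_card (Finset.erase_subset _ _)
          nlinarith [mul_nonneg (Nat.cast_nonneg (α := ℝ) d₂) h0]

/-- The influence of `i ∈ J` is at most its degree in `J` up to a small error. -/
lemma condExpect_sub_erase_le {p : ℝ} (h0 : 0 ≤ p) (E : Finset β) (T : β → Finset α)
    {J : Finset α} {i : α} :
    condExpect p E T J - condExpect p E T (J.erase i) ≤
      ∑ e ∈ E with (i ∈ T e ∧ ¬ T e ⊆ J), p ^ (T e \ J).card +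
        {e ∈ E | i ∈ T e ∧ T e ⊆ J}.card := by
  rw [condExpect, condExpect, ← Finset.sum_sub_distrib, Finset.sum_filter, ← Finset.sum_boole,
    ← Finset.sum_add_distrib]
  refine Finset.sum_le_sum fun e _ => ?_
  have hp : 0 ≤ p ^ (T e \ J.erase i).card := pow_nonneg h0 _
  by_cases hie : i ∈ T e
  · by_cases hJ : T e ⊆ J
    · simp only [hie, hJ, Finset.sdiff_eq_empty_iff_subset.2 hJ]
      simpa using hp
    · simp only [hie, hJ]
      simpa using hp
  · have : T e \ J.erase i = T e \ J := by
      ext x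
      simp only [Finset.mem_sdiff, Finset.mem_erase]
      grind
    simp [hie, this]

/-- The conditional expectation is at most the expectation plus the number of planted hyperedges,
up to a small error. -/
lemma condExpect_le {p : ℝ} (h0 : 0 ≤ p) {E : Finset β} {T : β → Finset α} {k : ℕ}
    (hk : ∀ e ∈ E, (T e).card = k) (J : Finset α) :
    condExpect p E T J ≤ E.card * p ^ k +
      ∑ i ∈ J, ∑ e ∈ E with (i ∈ T e ∧ ¬ T e ⊆ J), p ^ (T e \ J).card + edgeCount E T J := by
  have hpk : 0 ≤ p ^ k := pow_nonneg h0 _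
  simp_rw [condExpect, edgeCount, Finset.sum_filter]
  rw [Finset.sum_comm, ← Finset.sum_boole, ← nsmul_eq_mul, ← Finset.sum_const,
    ← Finset.sum_add_distrib, ← Finset.sum_add_distrib]
  refine Finset.sum_le_sum fun e he => ?_
  have hnn : ∀ i ∈ J, 0 ≤ if i ∈ T e ∧ ¬ T e ⊆ J then p ^ (T e \ J).card else 0 := fun i _ => by
    split_ifs <;> positivity
  have hs := Finset.sum_nonneg hnn
  by_cases hJ : T e ⊆ J
  · simp only [hJ, Finset.sdiff_eq_empty_iff_subset.2 hJ]
    simpa using hpk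
  by_cases hi : ∃ i ∈ J, i ∈ T e
  · obtain ⟨i, hi, hie⟩ := hi
    have h2 := Finset.single_le_sum hnn hi
    simp only [hie, hJ, not_false_eq_true, and_self, if_true] at h2 ⊢
    simp only [if_false]
    refine h2.trans ?_
    simp only [hJ, not_false_eq_true, and_true] at hs ⊢
    linarith
  · push Not at hi
    have : T e \ J = T e := Finset.sdiff_eq_self_of_disjoint
      (Finset.disjoint_left.2 fun x hx hxJ => hi x hxJ hx)
    rw [this, hk e he]
    have : 0 ≤ if T e ⊆ J then (1 : ℝ) else 0 := by split_ifs <;> simp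
    rw [‹T e \ J = T e›, hk e he] at hs
    linarith

/-- Each planted edge raises its own weight from `p ^ k` to `1`, and planting lowers no weight. -/
lemma le_condExpect {p : ℝ} (h0 : 0 ≤ p) (h1 : p ≤ 1) {E : Finset β} {T : β → Finset α} {k : ℕ}
    (hk : ∀ e ∈ E, (T e).card = k) (J : Finset α) :
    E.card * p ^ k + edgeCount E T J * (1 - p ^ k) ≤ condExpect p E T J := by
  rw [edgeCount, ← Finset.sum_boole, Finset.sum_mul, ← nsmul_eq_mul, ← Finset.sum_const,
    ← Finset.sum_add_distrib, condExpect]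
  refine Finset.sum_le_sum fun e he => ?_
  split_ifs with hJ
  · simp [Finset.sdiff_eq_empty_iff_subset.2 hJ]
  · rw [zero_mul, add_zero]
    exact pow_le_pow_of_le_one h0 h1 ((Finset.card_le_card Finset.sdiff_subset).trans (hk e he).le)

end Influence

/-! ### Degrees, codegrees and the extremal number of progressions in a set of given size. -/

section ProgressionCounts

lemma card_apEdges_mem_le {k : ℕ} (N x : ℕ) :
    {e ∈ apEdges k N | x ∈ apTerms k e}.card ≤ k * N := by
  have h : {e ∈ apEdges k N | x ∈ apTerms k e} ⊆
      (Finset.range k ×ˢ Finset.Icc 1 N).image fun ib => (x - ib.1 * ib.2, ib.2) := by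
    intro e he
    simp only [Finset.mem_filter, apEdges, Finset.mem_product] at he
    obtain ⟨i, hi, rfl⟩ := mem_apTerms.1 he.2
    refine Finset.mem_image.2 ⟨(i, e.2), ?_, ?_⟩
    · exact Finset.mem_product.2 ⟨Finset.mem_range.2 hi, he.1.1.2⟩
    · simp
  refine (Finset.card_le_card h).trans (Finset.card_image_le.trans ?_)
  simp

lemma ap_ext {i j : ℕ} (hij : i ≠ j) {e f : ℕ × ℕ} (h1 : e.1 + i * e.2 = f.1 + i * f.2)
    (h2 : e.1 + j * e.2 = f.1 + j * f.2) : e = f := by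
  have h3 : ((j : ℤ) - i) * ((e.2 : ℤ) - f.2) = 0 := by
    zify at h1 h2
    linear_combination h2 - h1
  have h4 : e.2 = f.2 := by
    rcases mul_eq_zero.1 h3 with h | h <;> omega
  refine Prod.ext ?_ h4
  rw [h4] at h1
  omega

/-- Two distinct terms together with their positions determine a progression. -/
lemma card_apEdges_mem_mem_le {k : ℕ} (N : ℕ) {x y : ℕ} (hxy : x ≠ y) :
    {e ∈ apEdges k N | x ∈ apTerms k e ∧ y ∈ apTerms k e}.card ≤ k ^ 2 := by
  have h : {e ∈ apEdges k N | x ∈ apTerms k e ∧ y ∈ apTerms k e} ⊆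
      (Finset.range k ×ˢ Finset.range k).biUnion fun ij =>
        {e ∈ apEdges k N | e.1 + ij.1 * e.2 = x ∧ e.1 + ij.2 * e.2 = y} := by
    intro e he
    simp only [Finset.mem_filter] at he
    obtain ⟨i, hi, hx⟩ := mem_apTerms.1 he.2.1
    obtain ⟨j, hj, hy⟩ := mem_apTerms.1 he.2.2
    simp only [Finset.mem_biUnion, Finset.mem_product, Finset.mem_range, Finset.mem_filter]
    exact ⟨(i, j), ⟨hi, hj⟩, he.1, hx, hy⟩
  refine (Finset.card_le_card h).trans (Finset.card_biUnion_le.trans ?_)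
  calc _ ≤ ∑ ij ∈ Finset.range k ×ˢ Finset.range k, 1 := by
        refine Finset.sum_le_sum fun ij _ => ?_
        refine Finset.card_le_one.2 fun e he f hf => ?_
        simp only [Finset.mem_filter] at he hf
        refine ap_ext (i := ij.1) (j := ij.2) (fun h => hxy ?_) (he.2.1.trans hf.2.1.symm)
          (he.2.2.trans hf.2.2.symm)
        rw [← he.2.1, ← he.2.2, h]
    _ = k ^ 2 := by simp [sq]

lemma two_mul_card_pairs_lt (J : Finset ℕ) (B : ℕ → ℕ) :
    2 * {xy ∈ J ×ˢ J | xy.1 < xy.2 ∧ B xy.1 = B xy.2}.card =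
      ∑ x ∈ J, {y ∈ J.erase x | B y = B x}.card := by
  have h1 : ∀ x ∈ J, {y ∈ J.erase x | B y = B x}.card =
      {y ∈ J | x < y ∧ B x = B y}.card + {y ∈ J | y < x ∧ B y = B x}.card := by
    intro x hx
    rw [← Finset.card_union_of_disjoint]
    · congr 1
      ext y
      simp only [Finset.mem_filter, Finset.mem_erase, Finset.mem_union]
      constructor
      · rintro ⟨⟨h1, h2⟩, h3⟩
        rcases lt_or_gt_of_ne h1 with h | h
        · exact Or.inr ⟨h2, h, h3⟩
        · exact Or.inl ⟨h2, h, h3.symm⟩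
      · rintro (⟨h1, h2, h3⟩ | ⟨h1, h2, h3⟩)
        · exact ⟨⟨h2.ne', h1⟩, h3.symm⟩
        · exact ⟨⟨h2.ne, h1⟩, h3⟩
    · rw [Finset.disjoint_left]
      intro y hy hy'
      simp only [Finset.mem_filter] at hy hy'
      omega
  rw [Finset.sum_congr rfl h1, Finset.sum_add_distrib, two_mul]
  congr 1
  · simp_rw [Finset.card_filter, Finset.sum_product]
  · simp_rw [Finset.card_filter, Finset.sum_product]
    rw [Finset.sum_comm]

/-- A set of `m` integers contains at most `m ^ 2 / (2 (k - 1))` arithmetic progressions of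
length `k`: cutting the set into `k - 1` blocks of consecutive elements, each progression has its
`j`-th and `(j + 1)`-st terms in the `j`-th block for some `j`. -/
lemma edgeCount_ap_le {k : ℕ} (hk : 2 ≤ k) (N : ℕ) (J : Finset ℕ) :
    2 * (k - 1) * edgeCount (apEdges k N) (apTerms k) J ≤ J.card ^ 2 := by
  obtain ⟨K, rfl⟩ : ∃ K, k = K + 1 := ⟨k - 1, by omega⟩
  rw [Nat.add_sub_cancel]
  set m := J.card with hm
  rcases Nat.eq_zero_or_pos m with hm0 | hm0
  · have hJ : J = ∅ := Finset.card_eq_zero.1 (hm.symm.trans hm0)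
    rw [hJ, edgeCount, Finset.filter_eq_empty_iff.2, Finset.card_empty]
    · simp
    · intro e he hsub
      have := card_apTerms hk he
      rw [Finset.subset_empty.1 hsub] at this
      simp at this
  -- `r` is the rank within `J`, and `B` numbers the `K` blocks from `0` to `K - 1`.
  set r : ℕ → ℕ := fun x => {y ∈ J | y < x}.card with hr
  set B : ℕ → ℕ := fun x => r x * K / m with hB
  have hrmono : Monotone r := fun x y hxy => by
    refine Finset.card_le_card fun z hz => ?_
    simp only [Finset.mem_filter] at hz ⊢
    exact ⟨hz.1, hz.2.trans_le hxy⟩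
  have hBmono : Monotone B := fun x y hxy =>
    Nat.div_le_div_right (Nat.mul_le_mul_right _ (hrmono hxy))
  have hrlt : ∀ x ∈ J, ∀ y, x < y → r x < r y := by
    intro x hx y hxy
    refine Finset.card_lt_card (Finset.ssubset_iff_subset_ne.2 ⟨?_, ?_⟩)
    · intro z hz
      simp only [Finset.mem_filter] at hz ⊢
      exact ⟨hz.1, hz.2.trans hxy⟩
    · intro h
      have : x ∈ ({y ∈ J | y < x} : Finset ℕ) := by rw [h]; simp [hx, hxy]
      simp at this
  have hrm : ∀ x ∈ J, r x < m := by
    intro x hx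
    refine Finset.card_lt_card (Finset.filter_ssubset.2 ⟨x, hx, by simp⟩)
  have hBK : ∀ x ∈ J, B x < K := by
    intro x hx
    rw [hB, Nat.div_lt_iff_lt_mul hm0, mul_comm K]
    exact Nat.mul_lt_mul_of_pos_right (hrm x hx) (by omega)
  set Q : Finset (ℕ × ℕ) := {xy ∈ J ×ˢ J | xy.1 < xy.2 ∧ B xy.1 = B xy.2} with hQ
  have hcount : edgeCount (apEdges (K + 1) N) (apTerms (K + 1)) J ≤ Q.card := by
    rw [edgeCount]
    -- The progression is recovered from the pair `x < y` of consecutive terms in a common block: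
    -- the difference is `y - x`, and the position of `x` in the progression is its block number.
    have hsub : {e ∈ apEdges (K + 1) N | apTerms (K + 1) e ⊆ J} ⊆
        Q.image fun xy => (xy.1 - B xy.1 * (xy.2 - xy.1), xy.2 - xy.1) := by
      intro e he
      simp only [Finset.mem_filter, mem_apEdges hk] at he
      obtain ⟨⟨ha, hb, -⟩, hsub⟩ := he
      have hmem : ∀ i ≤ K, e.1 + i * e.2 ∈ J := fun i hi =>
        hsub (mem_apTerms.2 ⟨i, by omega, rfl⟩)
      -- For the least such `j`, minimality gives `j ≤ B (a + j b)`, and monotonicity of `B` forces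
      -- terms `j` and `j + 1` both into block `j`.
      have hex : ∃ j, B (e.1 + (j + 1) * e.2) ≤ j := ⟨K - 1, by
        have := hBK _ (hmem K le_rfl)
        rw [Nat.sub_add_cancel (by omega)]
        omega⟩
      classical
      set j := Nat.find hex with hj
      have h1 : B (e.1 + (j + 1) * e.2) ≤ j := Nat.find_spec hex
      have hjK : j ≤ K - 1 := Nat.find_min' hex (by
        have := hBK _ (hmem K le_rfl)
        rw [Nat.sub_add_cancel (by omega)]
        omega)
      have h2 : j ≤ B (e.1 + j * e.2) := by
        rcases Nat.eq_zero_or_pos j with h | h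
        · omega
        · have h3 := Nat.find_min hex (m := j - 1) (by omega)
          rw [Nat.sub_add_cancel (by omega)] at h3
          omega
      have hlt : e.1 + j * e.2 < e.1 + (j + 1) * e.2 := by
        rw [add_mul, one_mul]
        omega
      have h3 := hBmono hlt.le
      have hBj : B (e.1 + j * e.2) = j := by omega
      refine Finset.mem_image.2 ⟨(e.1 + j * e.2, e.1 + (j + 1) * e.2), ?_, ?_⟩
      · simp only [hQ, Finset.mem_filter, Finset.mem_product]
        exact ⟨⟨hmem _ (by omega), hmem _ (by omega)⟩, hlt, by omega⟩
      · dsimp only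
        rw [hBj, add_mul, one_mul]
        have : e.1 + (j * e.2 + e.2) - (e.1 + j * e.2) = e.2 := by omega
        rw [this, Nat.add_sub_cancel]
    exact (Finset.card_le_card hsub).trans Finset.card_image_le
  -- The ranks in one block lie in an interval of at most `(m - 1) / K + 1` integers; leaving out
  -- `x` removes the extra `1`.
  have hblock : ∀ x ∈ J, K * {y ∈ J.erase x | B y = B x}.card ≤ m := by
    intro x hx
    set D : Finset ℕ := {y ∈ J | B y = B x} with hD
    have hxD : x ∈ D := by simp [hD, hx]
    have hDne : (D.image r).Nonempty := ⟨r x, Finset.mem_image_of_mem r hxD⟩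
    have hDcard : (D.image r).card = D.card := by
      refine Finset.card_image_of_injOn fun y hy z hz hyz => ?_
      simp only [hD, Finset.coe_filter, Set.mem_ofPred_eq] at hy hz
      rcases lt_trichotomy y z with h | h | h
      · exact absurd hyz (hrlt y hy.1 z h).ne
      · exact h
      · exact absurd hyz (hrlt z hz.1 y h).ne'
    have hbd : ∀ s ∈ D.image r, B x * m ≤ s * K ∧ s * K < (B x + 1) * m := by
      intro s hs
      obtain ⟨y, hy, rfl⟩ := Finset.mem_image.1 hs
      have hy2 : B y = B x := (Finset.mem_filter.1 hy).2
      rw [← hy2]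
      exact ⟨Nat.div_mul_le_self _ _, by
        rw [add_mul, one_mul]; exact Nat.lt_div_mul_add hm0⟩
    set s₀ := (D.image r).min' hDne with hs₀
    have h1 : B x * m ≤ s₀ * K := (hbd _ ((D.image r).min'_mem hDne)).1
    have hsub : D.image r ⊆ Finset.Icc s₀ (s₀ + (m - 1) / K) := by
      intro s hs
      have h2 := (hbd s hs).2
      have h3 : s₀ ≤ s := (D.image r).min'_le s hs
      rw [Finset.mem_Icc]
      refine ⟨h3, ?_⟩
      have h4 : (s - s₀) * K ≤ m - 1 := by
        rw [Nat.sub_mul]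
        rw [add_mul, one_mul] at h2
        omega
      have := (Nat.le_div_iff_mul_le (by omega)).2 h4
      omega
    have h5 := Finset.card_le_card hsub
    rw [hDcard, Nat.card_Icc] at h5
    have h6 : ({y ∈ J.erase x | B y = B x} : Finset ℕ) = D.erase x := by
      rw [Finset.filter_erase]
    rw [h6, Finset.card_erase_of_mem hxD]
    calc K * (D.card - 1) ≤ K * ((m - 1) / K) := Nat.mul_le_mul_left _ (by
          generalize (m - 1) / K = t at h5
          omega)
      _ ≤ m - 1 := Nat.mul_div_le _ _
      _ ≤ m := by omega
  have hsum := two_mul_card_pairs_lt J B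
  calc 2 * K * edgeCount (apEdges (K + 1) N) (apTerms (K + 1)) J
      ≤ 2 * K * Q.card := Nat.mul_le_mul_left _ hcount
    _ = K * (2 * Q.card) := by ring
    _ = ∑ x ∈ J, K * {y ∈ J.erase x | B y = B x}.card := by rw [hsum, Finset.mul_sum]
    _ ≤ ∑ x ∈ J, m := Finset.sum_le_sum hblock
    _ = m ^ 2 := by rw [Finset.sum_const, smul_eq_mul, ← hm, sq]

lemma edgeCount_ap_Icc {k : ℕ} (hk : 2 ≤ k) {m N : ℕ} (hmN : m ≤ N) :
    edgeCount (apEdges k N) (apTerms k) (Finset.Icc 1 m) = (apEdges k m).card := by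
  rw [edgeCount]
  congr 1
  ext e
  simp only [Finset.mem_filter]
  constructor
  · rintro ⟨h1, h2⟩
    rw [mem_apEdges hk] at h1 ⊢
    have h3 := Finset.mem_Icc.1 (h2 (mem_apTerms.2 ⟨k - 1, by omega, rfl⟩))
    exact ⟨h1.1, h1.2.1, h3.2⟩
  · intro h1
    refine ⟨?_, apTerms_subset hk h1⟩
    rw [mem_apEdges hk] at h1 ⊢
    exact ⟨h1.1, h1.2.1, h1.2.2.trans hmN⟩

lemma card_apEdges_le {k : ℕ} (hk : 2 ≤ k) (N : ℕ) :
    2 * (k - 1) * (apEdges k N).card ≤ N ^ 2 := by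
  have h := edgeCount_ap_le hk N (Finset.Icc 1 N)
  rwa [edgeCount_ap_Icc hk le_rfl, Nat.card_Icc, Nat.add_sub_cancel] at h

/-- A progression starting at `m - j` may have any of `⌊j / (k - 1)⌋` differences. Together with
`card_apEdges_le` this determines the count up to a linear error and shows that intervals are
asymptotically extremal. -/
lemma le_card_apEdges {k : ℕ} (hk : 2 ≤ k) (m : ℕ) :
    (m : ℝ) ^ 2 ≤ 2 * (k - 1) * (apEdges k m).card + 2 * k * m := by
  obtain ⟨K, rfl⟩ : ∃ K, k = K + 1 := ⟨k - 1, by omega⟩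
  have hK : (0 : ℝ) < K := by exact_mod_cast (by omega : 0 < K)
  have h1 : ∑ j ∈ Finset.range m, j / K ≤ (apEdges (K + 1) m).card := by
    have : ∑ j ∈ Finset.range m, j / K =
        ((Finset.range m).sigma fun j => Finset.range (j / K)).card := by simp
    rw [this]
    refine Finset.card_le_card_of_injOn (fun jb => (m - jb.1, jb.2 + 1)) ?_ ?_
    · rintro ⟨j, b⟩ hjb
      simp only [Finset.coe_sigma, Set.mem_sigma_iff, Finset.mem_coe, Finset.mem_range] at hjb
      rw [Finset.mem_coe, mem_apEdges hk]
      have h2 : (b + 1) * K ≤ j := (Nat.le_div_iff_mul_le (by omega)).1 hjb.2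
      refine ⟨by simp; omega, by simp, ?_⟩
      simp only [Nat.add_sub_cancel]
      rw [mul_comm]
      omega
    · rintro ⟨j, b⟩ hjb ⟨j', b'⟩ hjb' h
      simp only [Finset.coe_sigma, Set.mem_sigma_iff, Finset.mem_coe, Finset.mem_range] at hjb hjb'
      simp only [Prod.mk.injEq] at h
      obtain rfl : j = j' := by omega
      obtain rfl : b = b' := by omega
      rfl
  have h2 : ∀ m : ℕ, (m : ℝ) ^ 2 ≤ 2 * K * (∑ j ∈ Finset.range m, j / K : ℕ) + 2 * (K + 1) * m := by
    intro m
    induction m with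
    | zero => simp
    | succ m ih =>
      rw [Finset.sum_range_succ]
      have h3 : (m : ℝ) ≤ K * (m / K : ℕ) + K := by
        have := (Nat.lt_div_mul_add (a := m) (b := K) (by omega)).le
        rw [mul_comm] at this
        exact_mod_cast this
      push_cast at ih h3 ⊢
      nlinarith
  refine (h2 m).trans ?_
  have h3 : ((∑ j ∈ Finset.range m, j / K : ℕ) : ℝ) ≤ (apEdges (K + 1) m).card := by
    exact_mod_cast h1
  push_cast at h3 ⊢
  nlinarith

end ProgressionCounts

/-! ### Counting vertex sets of large minimum degree through fingerprints. -/

section CoreCounting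

lemma exists_le_of_weighted_sum_le {ι : Type*} {s : Finset ι} {w g : ι → ℝ} {c : ℝ}
    (hw : ∀ i ∈ s, 0 ≤ w i) (hw1 : ∑ i ∈ s, w i = 1) (h : ∑ i ∈ s, w i * g i ≤ c) :
    ∃ i ∈ s, g i ≤ c := by
  by_contra! hc
  have hex : ∃ i ∈ s, 0 < w i := by
    by_contra! h0
    have := Finset.sum_nonpos h0
    linarith
  obtain ⟨i, hi, hwi⟩ := hex
  have : ∑ i ∈ s, w i * c < ∑ i ∈ s, w i * g i :=
    Finset.sum_lt_sum (fun j hj => mul_le_mul_of_nonneg_left (hc j hj).le (hw j hj))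
      ⟨i, hi, mul_lt_mul_of_pos_left (hc i hi) hwi⟩
  rw [← Finset.sum_mul, hw1, one_mul] at this
  linarith

/-- Exponential weighting: the indicator of `|G| ≤ r` is at most `y ^ (r - |G|)`, and the weights `y
^ (-|G|)` sum to `(1 + 1/y) ^ |U|`. -/
lemma card_powerset_card_le {α : Type*} (U : Finset α) {r y : ℝ} (hy : 1 ≤ y) :
    ({G ∈ U.powerset | (G.card : ℝ) ≤ r}.card : ℝ) ≤ y ^ r * Real.exp (U.card / y) := by
  have hy0 : 0 < y := by linarith
  have h1 : ({G ∈ U.powerset | (G.card : ℝ) ≤ r}.card : ℝ) ≤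
      ∑ G ∈ U.powerset, y ^ r * (1 / y) ^ G.card := by
    rw [← Finset.sum_boole]
    refine Finset.sum_le_sum fun G _ => ?_
    split_ifs with h
    · rw [one_div, inv_pow, ← Real.rpow_natCast, ← Real.rpow_neg hy0.le, ← Real.rpow_add hy0]
      exact Real.one_le_rpow hy (by linarith)
    · positivity
  refine h1.trans ?_
  have h2 := Finset.sum_pow_mul_eq_add_pow (1 / y) 1 U
  simp only [one_pow, mul_one] at h2
  rw [← Finset.mul_sum, h2]
  refine mul_le_mul_of_nonneg_left ?_ (by positivity)
  calc (1 / y + 1) ^ U.card ≤ Real.exp (1 / y) ^ U.card := by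
        gcongr
        exact Real.add_one_le_exp _
    _ = Real.exp (U.card / y) := by rw [← Real.exp_nat_mul]; ring_nf

variable {α β : Type*} [DecidableEq α]

/-- The number of hyperedges through `x` all of whose other vertices lie in `S`. -/
def linkCount (E : Finset β) (T : β → Finset α) (x : α) (S : Finset α) : ℕ :=
  {e ∈ E | x ∈ T e ∧ (T e).erase x ⊆ S}.card

lemma linkCount_mono (E : Finset β) (T : β → Finset α) (x : α) {S S' : Finset α} (h : S ⊆ S') :
    linkCount E T x S ≤ linkCount E T x S' := by
  refine Finset.card_le_card fun e he => ?_
  simp only [Finset.mem_filter] at he ⊢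
  exact ⟨he.1, he.2.1, he.2.2.trans h⟩

/-- Few vertices complete many hyperedges with a given set `F`. -/
lemma card_linkCount_ge_le {E : Finset β} {T : β → Finset α} {k d : ℕ} (hk3 : 3 ≤ k)
    (hk : ∀ e ∈ E, (T e).card = k)
    (hd : ∀ x y, x ≠ y → {e ∈ E | x ∈ T e ∧ y ∈ T e}.card ≤ d) (V F : Finset α) (s : ℝ) :
    s * {x ∈ V | s ≤ linkCount E T x F}.card ≤ k * d * F.card ^ 2 := by
  set D := {x ∈ V | s ≤ linkCount E T x F} with hD
  have h1 : s * D.card ≤ ∑ x ∈ D, (linkCount E T x F : ℝ) := by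
    rw [mul_comm, ← nsmul_eq_mul]
    exact Finset.card_nsmul_le_sum _ _ _ fun x hx => (Finset.mem_filter.1 hx).2
  -- Double counting: as `k ≥ 3`, an edge with all vertices but one in `F` contains two distinct
  -- vertices of `F`; each such pair lies in at most `d` edges, and an edge has `k` choices of `x`.
  have h2 : ∑ x ∈ D, linkCount E T x F ≤
      ∑ yz ∈ F.offDiag, ∑ e ∈ E with (yz.1 ∈ T e ∧ yz.2 ∈ T e), (T e).card := by
    have e1 : ∀ x, linkCount E T x F = ∑ e ∈ E, if x ∈ T e ∧ (T e).erase x ⊆ F then 1 else 0 :=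
      fun x => Finset.card_filter _ _
    simp_rw [e1, Finset.sum_filter]
    rw [Finset.sum_comm, Finset.sum_comm (s := F.offDiag)]
    refine Finset.sum_le_sum fun e he => ?_
    by_cases hx : ∃ x ∈ T e, (T e).erase x ⊆ F
    · obtain ⟨x, hxe, hxF⟩ := hx
      have hcard : 1 < ((T e).erase x).card := by
        rw [Finset.card_erase_of_mem hxe, hk e he]
        omega
      obtain ⟨y, hy, z, hz, hyz⟩ := Finset.one_lt_card.1 hcard
      have h3 := Finset.single_le_sum (f := fun yz : α × α =>
        if yz.1 ∈ T e ∧ yz.2 ∈ T e then (T e).card else 0) (fun _ _ => Nat.zero_le _)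
        (Finset.mem_offDiag.2 ⟨hxF hy, hxF hz, hyz⟩ : (y, z) ∈ F.offDiag)
      simp only [Finset.mem_of_mem_erase hy, Finset.mem_of_mem_erase hz, and_self, if_true] at h3
      refine le_trans ?_ h3
      rw [← Finset.card_filter]
      refine Finset.card_le_card fun w hw => ?_
      exact (Finset.mem_filter.1 hw).2.1
    · push Not at hx
      rw [Finset.sum_eq_zero]
      · exact Nat.zero_le _
      · intro x _
        rw [if_neg]
        rintro ⟨h4, h5⟩
        exact hx x h4 h5
  have h3 : ∑ yz ∈ F.offDiag, ∑ e ∈ E with (yz.1 ∈ T e ∧ yz.2 ∈ T e), (T e).card ≤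
      k * d * F.card ^ 2 := by
    calc _ ≤ ∑ yz ∈ F.offDiag, d * k := by
          refine Finset.sum_le_sum fun yz hyz => ?_
          rw [Finset.sum_congr rfl fun e he => hk e (Finset.mem_filter.1 he).1, Finset.sum_const,
            smul_eq_mul]
          exact Nat.mul_le_mul_right _ (hd _ _ (Finset.mem_offDiag.1 hyz).2.2)
      _ ≤ k * d * F.card ^ 2 := by
          rw [Finset.sum_const, smul_eq_mul, Finset.offDiag_card, mul_comm, mul_comm d, sq]
          exact Nat.mul_le_mul_left _ (Nat.sub_le _ _)
  refine h1.trans ?_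
  exact_mod_cast h2.trans h3

/-- Second moment estimate for the number of hyperedges through `i` whose other vertices lie in a
`q`-random subset. -/
lemma sum_bernoulliWeight_linkCount_lt_le {q : ℝ} (hq0 : 0 < q) (hq1 : q ≤ 1) {E : Finset β}
    {T : β → Finset α} {k d : ℕ} (hk : ∀ e ∈ E, (T e).card = k)
    (hd : ∀ x y, x ≠ y → {e ∈ E | x ∈ T e ∧ y ∈ T e}.card ≤ d) {J : Finset α} {i : α} {t : ℝ}
    (ht : 0 < t) (hi : t ≤ {e ∈ E | i ∈ T e ∧ T e ⊆ J}.card) :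
    ∑ S ∈ J.powerset with linkCount E T i S < q ^ (k - 1) * t / 2, bernoulliWeight q J S ≤
      4 * k * d / (t * q ^ (2 * (k - 1))) := by
  have hw := fun S => bernoulliWeight_nonneg hq0.le hq1 J S
  set Ei := {e ∈ E | i ∈ T e ∧ T e ⊆ J} with hEi
  set A : β → Finset α := fun e => (T e).erase i with hA
  have hAJ : ∀ e ∈ Ei, A e ⊆ J := fun e he =>
    (Finset.erase_subset _ _).trans (Finset.mem_filter.1 he).2.2
  have hAc : ∀ e ∈ Ei, (A e).card = k - 1 := fun e he => by
    rw [hA, Finset.card_erase_of_mem (Finset.mem_filter.1 he).2.1, hk e (Finset.mem_filter.1 he).1]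
  set D : ℝ := (Ei.card : ℝ) with hD
  have hDpos : 0 < D := ht.trans_le hi
  set μ : ℝ := D * q ^ (k - 1) with hμ
  have hμpos : 0 < μ := by positivity
  set Z : Finset α → ℝ := fun S => (edgeCount Ei A S : ℝ) with hZ
  have htot : ∑ S ∈ J.powerset, bernoulliWeight q J S = 1 := by
    have := sum_bernoulliWeight_superset q (Finset.empty_subset J)
    simpa using this
  have hm1 : ∑ S ∈ J.powerset, bernoulliWeight q J S * Z S = μ := by
    have h := sum_bernoulliWeight_edgeCount q (Finset.empty_subset J) Ei A hAJ
    simp only [Finset.empty_subset, Finset.filter_true, Finset.card_empty, pow_zero, one_mul] at h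
    rw [h, condExpect, hμ, hD, ← nsmul_eq_mul, ← Finset.sum_const]
    exact Finset.sum_congr rfl fun e he => by rw [Finset.sdiff_empty, hAc e he]
  -- Links of `e` and `f` are correlated only if they share a vertex `y`; then `f` contains both `i`
  -- and `y`, so at most `(k - 1) d` edges `f` matter for each `e`.
  have hm2 : ∑ S ∈ J.powerset, bernoulliWeight q J S * Z S ^ 2 ≤ μ ^ 2 + D * (k * d) := by
    have h := sum_mul_edgeCount J Ei A (fun _ => True) (fun S => bernoulliWeight q J S * Z S)
    simp only [Finset.filter_true, and_true] at h
    calc ∑ S ∈ J.powerset, bernoulliWeight q J S * Z S ^ 2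
        = ∑ S ∈ J.powerset, bernoulliWeight q J S * Z S * (edgeCount Ei A S : ℝ) :=
          Finset.sum_congr rfl fun S _ => by rw [hZ]; ring
      _ = ∑ e ∈ Ei, q ^ (A e).card * condExpect q Ei A (A e) := by
          rw [h]
          exact Finset.sum_congr rfl fun e he =>
            sum_bernoulliWeight_edgeCount q (hAJ e he) Ei A hAJ
      _ ≤ ∑ e ∈ Ei, (q ^ (k - 1) * μ + k * d) := by
          refine Finset.sum_le_sum fun e he => ?_
          rw [hAc e he]
          have h4 : condExpect q Ei A (A e) ≤ μ + k * d := by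
            have h5 : ∀ f ∈ Ei, q ^ (A f \ A e).card ≤ q ^ (k - 1) +
                ∑ y ∈ A e, if i ∈ T f ∧ y ∈ T f then 1 else 0 := by
              intro f hf
              by_cases hdis : Disjoint (A f) (A e)
              · rw [Finset.sdiff_eq_self_of_disjoint hdis, hAc f hf]
                exact le_add_of_nonneg_right
                  (Finset.sum_nonneg fun y _ => by split_ifs <;> norm_num)
              · rw [Finset.not_disjoint_iff] at hdis
                obtain ⟨y, hyf, hye⟩ := hdis
                have h6 := Finset.single_le_sum (f := fun y : α =>
                  if i ∈ T f ∧ y ∈ T f then (1 : ℝ) else 0)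
                  (fun y _ => by split_ifs <;> norm_num) hye
                simp only [(Finset.mem_filter.1 hf).2.1, Finset.mem_of_mem_erase hyf, and_self,
                  if_true] at h6
                have h7 : q ^ (A f \ A e).card ≤ 1 := pow_le_one₀ hq0.le hq1
                have h8 : 0 < q ^ (k - 1) := by positivity
                simp only [(Finset.mem_filter.1 hf).2.1]
                linarith
            refine (Finset.sum_le_sum h5).trans ?_
            rw [Finset.sum_add_distrib, Finset.sum_const, nsmul_eq_mul, ← hD, ← hμ, Finset.sum_comm]
            have h6 : ∑ y ∈ A e, ∑ f ∈ Ei, (if i ∈ T f ∧ y ∈ T f then (1 : ℝ) else 0) ≤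
                ∑ y ∈ A e, (d : ℝ) := by
              refine Finset.sum_le_sum fun y hy => ?_
              rw [Finset.sum_boole]
              refine Nat.cast_le.2 (le_trans (Finset.card_le_card ?_)
                (hd i y (Finset.ne_of_mem_erase hy).symm))
              exact Finset.filter_subset_filter _ (Finset.filter_subset _ _)
            rw [Finset.sum_const, nsmul_eq_mul, hAc e he] at h6
            have h7 : ((k - 1 : ℕ) : ℝ) ≤ k := by exact_mod_cast Nat.sub_le _ _
            have h8 : ((k - 1 : ℕ) : ℝ) * d ≤ k * d := by gcongr
            linarith
          have h9 : q ^ (k - 1) ≤ 1 := pow_le_one₀ hq0.le hq1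
          have h10 : 0 < q ^ (k - 1) := by positivity
          have h11 : (0 : ℝ) ≤ k * d := by positivity
          nlinarith
      _ = μ ^ 2 + D * (k * d) := by
          rw [Finset.sum_const, nsmul_eq_mul, ← hD, hμ]
          ring
  have hvar : ∑ S ∈ J.powerset, bernoulliWeight q J S * (Z S - μ) ^ 2 ≤ D * (k * d) := by
    have : ∀ S ∈ J.powerset, bernoulliWeight q J S * (Z S - μ) ^ 2 =
        bernoulliWeight q J S * Z S ^ 2 - 2 * μ * (bernoulliWeight q J S * Z S) +
          μ ^ 2 * bernoulliWeight q J S := fun S _ => by ring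
    rw [Finset.sum_congr rfl this, Finset.sum_add_distrib, Finset.sum_sub_distrib,
      ← Finset.mul_sum, ← Finset.mul_sum, hm1, htot]
    nlinarith
  have hlink : ∀ S, Z S ≤ linkCount E T i S := by
    intro S
    refine Nat.cast_le.2 (Finset.card_le_card fun e he => ?_)
    simp only [hEi, Finset.mem_filter, hA] at he ⊢
    exact ⟨he.1.1, he.1.2.1, he.2⟩
  have hμt : q ^ (k - 1) * t ≤ μ := by
    rw [hμ, mul_comm]
    gcongr
  -- Chebyshev: since `Z ≤ linkCount` and `q ^ (k - 1) * t ≤ μ`, the event forces `Z` to fall at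
  -- least `μ / 2` below its mean.
  have hcheb : μ ^ 2 / 4 * ∑ S ∈ J.powerset with linkCount E T i S < q ^ (k - 1) * t / 2,
      bernoulliWeight q J S ≤ D * (k * d) := by
    rw [Finset.mul_sum, Finset.sum_filter]
    refine le_trans (Finset.sum_le_sum fun S _ => ?_) hvar
    split_ifs with h
    · have h1 : μ / 2 ≤ μ - Z S := by linarith [hlink S]
      have h2 : μ ^ 2 / 4 ≤ (Z S - μ) ^ 2 := by nlinarith
      rw [mul_comm]
      exact mul_le_mul_of_nonneg_left h2 (hw S)
    · exact mul_nonneg (hw S) (sq_nonneg _)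
  set P := ∑ S ∈ J.powerset with linkCount E T i S < q ^ (k - 1) * t / 2, bernoulliWeight q J S
    with hP
  have hPnn : 0 ≤ P := Finset.sum_nonneg fun S _ => hw S
  rw [le_div_iff₀ (by positivity)]
  have h1 : D * (q ^ (2 * (k - 1)) * D * P) ≤ D * (4 * k * d) := by
    have : μ ^ 2 = D ^ 2 * q ^ (2 * (k - 1)) := by rw [hμ, mul_pow, ← pow_mul, mul_comm (k - 1)]
    rw [this] at hcheb
    nlinarith
  have h2 := le_of_mul_le_mul_left h1 hDpos
  have h3 : q ^ (2 * (k - 1)) * t * P ≤ q ^ (2 * (k - 1)) * D * P := by gcongr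
  nlinarith

/-- If every vertex of `J` has large degree in `J`, then `J` contains a small subset `F` with which
every other vertex of `J` completes many hyperedges. -/
lemma exists_fingerprint {q : ℝ} (hq0 : 0 < q) (hq1 : q ≤ 1) {E : Finset β}
    {T : β → Finset α} {k d : ℕ} (hk : ∀ e ∈ E, (T e).card = k)
    (hd : ∀ x y, x ≠ y → {e ∈ E | x ∈ T e ∧ y ∈ T e}.card ≤ d) {J : Finset α} {t : ℝ}
    (ht : 0 < t) (htq : 4 * k * d / (t * q ^ (2 * (k - 1))) ≤ q)
    (hJ : ∀ i ∈ J, t ≤ {e ∈ E | i ∈ T e ∧ T e ⊆ J}.card) :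
    ∃ F ⊆ J, (F.card : ℝ) ≤ 2 * q * J.card ∧
      ∀ i ∈ J \ F, q ^ (k - 1) * t / 2 ≤ linkCount E T i F := by
  have hw := fun S => bernoulliWeight_nonneg hq0.le hq1 J S
  set B : Finset α → Finset α := fun S => {i ∈ J | linkCount E T i S < q ^ (k - 1) * t / 2}
    with hB
  have htot : ∑ S ∈ J.powerset, bernoulliWeight q J S = 1 := by
    have := sum_bernoulliWeight_superset q (Finset.empty_subset J)
    simpa using this
  have h1 : ∑ S ∈ J.powerset, bernoulliWeight q J S * (S.card : ℝ) = q * J.card := by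
    have h := sum_bernoulliWeight_edgeCount q (Finset.empty_subset J) J (fun x => {x})
      (fun x hx => Finset.singleton_subset_iff.2 hx)
    simp only [Finset.empty_subset, Finset.filter_true, Finset.card_empty, pow_zero, one_mul,
      condExpect, Finset.sdiff_empty, Finset.card_singleton, pow_one, Finset.sum_const,
      nsmul_eq_mul] at h
    rw [mul_comm q, ← h]
    refine Finset.sum_congr rfl fun S hS => ?_
    rw [edgeCount]
    simp only [Finset.singleton_subset_iff, Finset.filter_mem_eq_inter]
    rw [Finset.inter_eq_right.2 (Finset.mem_powerset.1 hS)]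
  have h2 : ∑ S ∈ J.powerset, bernoulliWeight q J S * ((B S).card : ℝ) ≤ q * J.card := by
    have : ∀ S, ((B S).card : ℝ) =
        ∑ i ∈ J, if (linkCount E T i S : ℝ) < q ^ (k - 1) * t / 2 then 1 else 0 := by
      intro S
      rw [hB, Finset.sum_boole]
    simp_rw [this, Finset.mul_sum]
    rw [Finset.sum_comm]
    calc _ ≤ ∑ i ∈ J, q := by
          refine Finset.sum_le_sum fun i hi => le_trans ?_ htq
          refine le_trans (le_of_eq ?_)
            (sum_bernoulliWeight_linkCount_lt_le hq0 hq1 hk hd ht (hJ i hi))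
          rw [Finset.sum_filter]
          exact Finset.sum_congr rfl fun S _ => by split_ifs <;> simp
      _ = q * J.card := by rw [Finset.sum_const, nsmul_eq_mul, mul_comm]
  -- Both the random set and its set of failing vertices have mean size at most `q |J|`; adjoining
  -- the failing vertices to `S` gives the fingerprint.
  obtain ⟨S, hS, hle⟩ := exists_le_of_weighted_sum_le (g := fun S => (S.card : ℝ) + (B S).card)
    (fun S _ => hw S) htot (c := 2 * q * J.card) (by
      simp_rw [mul_add]
      rw [Finset.sum_add_distrib]
      linarith)
  refine ⟨S ∪ B S, Finset.union_subset (Finset.mem_powerset.1 hS) (Finset.filter_subset _ _),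
    ?_, ?_⟩
  · refine le_trans ?_ hle
    exact_mod_cast Finset.card_union_le _ _
  · intro i hi
    simp only [Finset.mem_sdiff, Finset.mem_union, not_or, hB, Finset.mem_filter, not_and,
      not_lt] at hi
    refine (hi.2.2 hi.1).trans ?_
    exact_mod_cast linkCount_mono E T i Finset.subset_union_left

/-- Bound for the number of vertex sets of a given size and large minimum degree. -/
lemma card_largeDegree_le {q : ℝ} (hq0 : 0 < q) (hq1 : q ≤ 1) {E : Finset β}
    {T : β → Finset α} {k d : ℕ} (hk3 : 3 ≤ k) (hk : ∀ e ∈ E, (T e).card = k)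
    (hd : ∀ x y, x ≠ y → {e ∈ E | x ∈ T e ∧ y ∈ T e}.card ≤ d) {t : ℝ}
    (ht : 0 < t) (htq : 4 * k * d / (t * q ^ (2 * (k - 1))) ≤ q) {V : Finset α} {m : ℕ}
    {C : Finset (Finset α)} (hCV : ∀ J ∈ C, J ⊆ V) (hCm : ∀ J ∈ C, J.card = m)
    (hC : ∀ J ∈ C, ∀ i ∈ J, t ≤ {e ∈ E | i ∈ T e ∧ T e ⊆ J}.card)
    {y₁ y₂ : ℝ} (hy₁ : 1 ≤ y₁) (hy₂ : 1 ≤ y₂) :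
    (C.card : ℝ) ≤ y₁ ^ (2 * q * m) * Real.exp (V.card / y₁) *
      (y₂ ^ (m : ℝ) * Real.exp (2 * k * d * m ^ 2 / (q ^ (k - 1) * t) / y₂)) := by
  classical
  set s := q ^ (k - 1) * t / 2 with hs
  have hs0 : 0 < s := by positivity
  set cand : Finset α → Finset α := fun F => {x ∈ V | s ≤ linkCount E T x F} with hcand
  set Fs : Finset (Finset α) := {F ∈ {F ∈ V.powerset | (F.card : ℝ) ≤ 2 * q * m} | F.card ≤ m}
    with hFs
  set Gs : Finset α → Finset (Finset α) := fun F =>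
    {G ∈ (cand F).powerset | (G.card : ℝ) ≤ m} with hGs
  -- `J` is its fingerprint `F` together with a subset of the few candidates determined by `F`.
  have hsub : C ⊆ (Fs.sigma Gs).image fun FG => FG.1 ∪ FG.2 := by
    intro J hJ
    obtain ⟨F, hFJ, hFc, hF⟩ := exists_fingerprint hq0 hq1 hk hd ht htq (hC J hJ)
    rw [hCm J hJ] at hFc
    refine Finset.mem_image.2 ⟨⟨F, J \ F⟩, ?_, Finset.union_sdiff_of_subset hFJ⟩
    simp only [hFs, hGs, hcand, Finset.mem_sigma, Finset.mem_filter, Finset.mem_powerset]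
    refine ⟨⟨⟨hFJ.trans (hCV J hJ), hFc⟩, ?_⟩, ?_, ?_⟩
    · rw [← hCm J hJ]
      exact Finset.card_le_card hFJ
    · intro x hx
      exact Finset.mem_filter.2 ⟨hCV J hJ (Finset.mem_sdiff.1 hx).1, hF x hx⟩
    · rw [← hCm J hJ]
      exact_mod_cast Finset.card_le_card Finset.sdiff_subset
  have h1 : C.card ≤ ∑ F ∈ Fs, (Gs F).card := by
    rw [← Finset.card_sigma]
    exact (Finset.card_le_card hsub).trans Finset.card_image_le
  have h2 : ∀ F ∈ Fs, ((Gs F).card : ℝ) ≤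
      y₂ ^ (m : ℝ) * Real.exp (2 * k * d * m ^ 2 / (q ^ (k - 1) * t) / y₂) := by
    intro F hF
    refine (card_powerset_card_le (cand F) hy₂).trans ?_
    refine mul_le_mul_of_nonneg_left (Real.exp_le_exp.2 ?_) (by positivity)
    refine div_le_div_of_nonneg_right ?_ (by linarith)
    have h3 := card_linkCount_ge_le hk3 hk hd V F s
    have h4 : (F.card : ℝ) ≤ m := by exact_mod_cast (Finset.mem_filter.1 hF).2
    have h5 : (2 : ℝ) * k * d * m ^ 2 / (q ^ (k - 1) * t) = k * d * m ^ 2 / s := by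
      rw [hs]; field_simp
    rw [h5, le_div_iff₀ hs0, mul_comm]
    refine h3.trans ?_
    gcongr
  calc (C.card : ℝ) ≤ ∑ F ∈ Fs, ((Gs F).card : ℝ) := by exact_mod_cast h1
    _ ≤ Fs.card * (y₂ ^ (m : ℝ) * Real.exp (2 * k * d * m ^ 2 / (q ^ (k - 1) * t) / y₂)) := by
        rw [← nsmul_eq_mul]
        exact Finset.sum_le_card_nsmul _ _ _ h2
    _ ≤ _ := by
        refine mul_le_mul_of_nonneg_right ?_ (by positivity)
        refine le_trans ?_ (card_powerset_card_le V (r := 2 * q * m) hy₁)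
        exact_mod_cast Finset.card_filter_le _ _

end CoreCounting

/-! ### Non-asymptotic bounds with free parameters. -/

section FiniteBounds

/-- A non-asymptotic upper bound for the upper tail probability. -/
lemma upperTailAP_le {k : ℕ} (hk : 3 ≤ k) {N l : ℕ} {p : unitInterval} {δ c τ t R q y₁ y₂ m₀ b : ℝ}
    (hx : 0 < (1 + δ) * ((apEdges k N).card * (p : ℝ) ^ k)) (hc : 0 ≤ c) (ht : 0 < t)
    (hR : k * N * (p : ℝ) ^ (k - 1) + k ^ 2 * (k * l) * p ≤ R) (hτ : t + R ≤ τ)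
    (hq0 : 0 < q) (hq1 : q ≤ 1) (htq : 4 * k * k ^ 2 / (t * q ^ (2 * (k - 1))) ≤ q)
    (hy₁ : 1 ≤ y₁) (hy₂ : 1 ≤ y₂)
    (hm₀ : m₀ ^ 2 ≤ 2 * (k - 1) * (c - k * l * τ - (apEdges k N).card * (p : ℝ) ^ k - k * l * R))
    (hb0 : 0 ≤ b)
    (hb : ∀ m : ℕ, m₀ ≤ m → m ≤ k * l →
      y₁ ^ (2 * q * m) * Real.exp (N / y₁) *
      (y₂ ^ (m : ℝ) * Real.exp (2 * k * k ^ 2 * m ^ 2 / (q ^ (k - 1) * t) / y₂)) * (p : ℝ) ^ m ≤ b) :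
    upperTailAP k N p δ ≤ (c / ((1 + δ) * ((apEdges k N).card * (p : ℝ) ^ k))) ^ l + (N + 1) * b := by
  classical
  have h0 : (0 : ℝ) ≤ p := p.2.1
  have h1 : (p : ℝ) ≤ 1 := p.2.2
  have hk2 : 2 ≤ k := by omega
  have hkR : (1 : ℝ) ≤ k := by exact_mod_cast (by omega : 1 ≤ k)
  set E := apEdges k N with hE
  set T := apTerms k with hT
  set V := Finset.Icc 1 N with hV
  have hTV : ∀ e ∈ E, T e ⊆ V := fun e he => apTerms_subset hk2 he
  have hTc : ∀ e ∈ E, (T e).card = k := fun e he => card_apTerms hk2 he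
  have hd1 : ∀ x, {e ∈ E | x ∈ T e}.card ≤ k * N := card_apEdges_mem_le N
  have hd2 : ∀ x y, x ≠ y → {e ∈ E | x ∈ T e ∧ y ∈ T e}.card ≤ k ^ 2 :=
    fun x y => card_apEdges_mem_mem_le N
  have hR0 : 0 ≤ R := le_trans (by positivity) hR
  have hτ0 : 0 ≤ τ := by linarith
  have hRJ : ∀ J : Finset ℕ, J.card ≤ k * l → ∀ i ∈ J,
      ∑ e ∈ E with (i ∈ T e ∧ ¬ T e ⊆ J), (p : ℝ) ^ (T e \ J).card ≤ R := by
    intro J hJ i hi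
    refine (sum_pow_sdiff_le h0 h1 hTc hd1 hd2 hi).trans (le_trans ?_ hR)
    have : (J.card : ℝ) ≤ k * l := by exact_mod_cast hJ
    push_cast
    gcongr
  -- The cores: reducing a set of at most `k * l` elements costs at most `k * l * τ` in conditional
  -- expectation.
  set C : Finset (Finset ℕ) := {J ∈ V.powerset | J.card ≤ k * l ∧
    c - k * l * τ < condExpect p E T J ∧
    ∀ i ∈ J, τ ≤ condExpect p E T J - condExpect p E T (J.erase i)} with hC
  have hcover : ∀ I ⊆ V, I.card ≤ k * l → c < condExpect p E T I → ∃ J ∈ C, J ⊆ I := by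
    intro I hIV hIc hI
    have : (I.card : ℝ) * τ ≤ k * l * τ := by
      have : (I.card : ℝ) ≤ k * l := by exact_mod_cast hIc
      gcongr
    obtain ⟨J, hJI, hJ1, hJ2⟩ := exists_core p E T (c := c - k * l * τ) hτ0 I (by linarith)
    refine ⟨J, ?_, hJI⟩
    simp only [hC, Finset.mem_filter, Finset.mem_powerset]
    exact ⟨hJI.trans hIV, (Finset.card_le_card hJI).trans hIc, hJ1, hJ2⟩
  have hdeg : ∀ J ∈ C, ∀ i ∈ J, t ≤ {e ∈ E | i ∈ T e ∧ T e ⊆ J}.card := by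
    intro J hJ i hi
    simp only [hC, Finset.mem_filter] at hJ
    have h2 := hJ.2.2.2 i hi
    have h3 := condExpect_sub_erase_le h0 E T (J := J) (i := i)
    have h4 := hRJ J hJ.2.1 i hi
    linarith
  -- A large conditional expectation requires many progressions inside `J`, and `edgeCount_ap_le`
  -- then forces `J` to be large.
  have hsize : ∀ J ∈ C, m₀ ≤ J.card := by
    intro J hJ
    simp only [hC, Finset.mem_filter] at hJ
    have h2 := condExpect_le h0 hTc J
    have h3 : ∑ i ∈ J, ∑ e ∈ E with (i ∈ T e ∧ ¬ T e ⊆ J), (p : ℝ) ^ (T e \ J).card ≤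
        k * l * R := by
      refine (Finset.sum_le_card_nsmul _ _ R (hRJ J hJ.2.1)).trans ?_
      rw [nsmul_eq_mul]
      have : (J.card : ℝ) ≤ k * l := by exact_mod_cast hJ.2.1
      gcongr
    have h4 : (2 : ℝ) * (k - 1) * edgeCount E T J ≤ J.card ^ 2 := by
      have := edgeCount_ap_le hk2 N J
      have h5 : (((k - 1 : ℕ) : ℝ)) = k - 1 := by
        rw [Nat.cast_sub (by omega), Nat.cast_one]
      rw [← h5]
      exact_mod_cast this
    refine le_of_sq_le_sq ?_ (Nat.cast_nonneg _)
    refine hm₀.trans (le_trans ?_ h4)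
    refine mul_le_mul_of_nonneg_left ?_ (by linarith)
    linarith [hJ.2.2.1]
  have hCV : ∀ J ∈ C, J ⊆ V := fun J hJ => Finset.mem_powerset.1 (Finset.mem_filter.1 hJ).1
  have hsum : ∑ J ∈ C, (p : ℝ) ^ J.card ≤ (N + 1) * b := by
    have hmaps : ∀ J ∈ C, J.card ∈ Finset.range (N + 1) := by
      intro J hJ
      have := Finset.card_le_card (hCV J hJ)
      rw [hV, Nat.card_Icc] at this
      rw [Finset.mem_range]
      omega
    rw [← Finset.sum_fiberwise_of_maps_to hmaps]
    calc _ ≤ ∑ m ∈ Finset.range (N + 1), b := by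
          refine Finset.sum_le_sum fun m _ => ?_
          rcases Finset.eq_empty_or_nonempty ({J ∈ C | J.card = m}) with hemp | ⟨J, hJ⟩
          · rw [hemp, Finset.sum_empty]
            exact hb0
          · obtain ⟨hJC, hJm⟩ := Finset.mem_filter.1 hJ
            have hm1 : m₀ ≤ m := hJm ▸ hsize J hJC
            have hm2 : m ≤ k * l := hJm ▸ (Finset.mem_filter.1 hJC).2.1
            rw [Finset.sum_congr rfl fun J hJ => by rw [(Finset.mem_filter.1 hJ).2],
              Finset.sum_const, nsmul_eq_mul]
            refine le_trans (mul_le_mul_of_nonneg_right ?_ (pow_nonneg h0 m)) (hb m hm1 hm2)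
            have h5 := card_largeDegree_le hq0 hq1 hk hTc hd2 ht (by exact_mod_cast htq)
              (V := V) (m := m) (C := {J ∈ C | J.card = m})
              (fun J hJ => hCV J (Finset.mem_filter.1 hJ).1)
              (fun J hJ => (Finset.mem_filter.1 hJ).2)
              (fun J hJ => hdeg J (Finset.mem_filter.1 hJ).1) hy₁ hy₂
            rw [hV, Nat.card_Icc, Nat.add_sub_cancel] at h5
            push_cast at h5
            exact h5
      _ = (N + 1) * b := by
          rw [Finset.sum_const, Finset.card_range, nsmul_eq_mul]
          push_cast
          rfl
  rw [upperTailAP_eq hk2]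
  refine (upperTail_le h0 h1 hTV (fun e he => (hTc e he).le) hc hx C hCV hcover).trans ?_
  exact add_le_add le_rfl hsum

/-- A non-asymptotic lower bound for the upper tail probability, obtained by planting the interval
`{1, …, m}`. -/
lemma le_upperTailAP {k : ℕ} (hk : 2 ≤ k) {N m : ℕ} (hmN : m ≤ N) {p : unitInterval} {δ : ℝ}
    (hδ : 0 ≤ δ) :
    (p : ℝ) ^ m * ((m ^ 2 - 2 * k * m) * (1 - (p : ℝ) ^ k) - δ * (N ^ 2 * (p : ℝ) ^ k)) ≤
      N ^ 2 * upperTailAP k N p δ := by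
  have h0 : (0 : ℝ) ≤ p := p.2.1
  have h1 : (p : ℝ) ≤ 1 := p.2.2
  have hkR : (2 : ℝ) ≤ k := by exact_mod_cast hk
  have hpk0 : 0 ≤ (p : ℝ) ^ k := by positivity
  have hpk : 0 ≤ 1 - (p : ℝ) ^ k := sub_nonneg.2 (pow_le_one₀ h0 h1)
  have hcard : 2 * ((k : ℝ) - 1) * (apEdges k N).card ≤ N ^ 2 := by
    have h5 : (((k - 1 : ℕ) : ℝ)) = k - 1 := by
      rw [Nat.cast_sub (by omega), Nat.cast_one]
    rw [← h5]
    exact_mod_cast card_apEdges_le hk N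
  have hI := le_upperTail h0 h1 (V := Finset.Icc 1 N) (I := Finset.Icc 1 m)
    (Finset.Icc_subset_Icc le_rfl hmN) (E := apEdges k N) (T := apTerms k)
    (fun e he => apTerms_subset hk he) (x := (1 + δ) * ((apEdges k N).card * (p : ℝ) ^ k))
    (by positivity)
  rw [← upperTailAP_eq hk, Nat.card_Icc, Nat.add_sub_cancel] at hI
  have hE := le_condExpect h0 h1 (fun e he => card_apTerms hk he) (E := apEdges k N)
    (T := apTerms k) (Finset.Icc 1 m)
  rw [edgeCount_ap_Icc hk hmN] at hE
  have hm := le_card_apEdges hk m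
  have hU : 0 ≤ upperTailAP k N p δ := measureReal_nonneg
  -- The factor `2 * (k - 1)` turns progression counts in intervals into squares of lengths.
  have h2 : (m ^ 2 - 2 * k * m) * (1 - (p : ℝ) ^ k) - δ * (N ^ 2 * (p : ℝ) ^ k) ≤
      2 * (k - 1) * (condExpect p (apEdges k N) (apTerms k) (Finset.Icc 1 m) -
        (1 + δ) * ((apEdges k N).card * (p : ℝ) ^ k)) := by
    have h3 : ((m : ℝ) ^ 2 - 2 * k * m) * (1 - (p : ℝ) ^ k) ≤
        2 * (k - 1) * (apEdges k m).card * (1 - (p : ℝ) ^ k) := by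
      refine mul_le_mul_of_nonneg_right ?_ hpk
      linarith
    have h4 : δ * (p : ℝ) ^ k * (2 * (k - 1) * (apEdges k N).card) ≤ δ * (p : ℝ) ^ k * N ^ 2 :=
      mul_le_mul_of_nonneg_left hcard (by positivity)
    have h5 : 2 * ((k : ℝ) - 1) * ((apEdges k N).card * (p : ℝ) ^ k +
        (apEdges k m).card * (1 - (p : ℝ) ^ k)) ≤ 2 * (k - 1) *
          condExpect p (apEdges k N) (apTerms k) (Finset.Icc 1 m) :=
      mul_le_mul_of_nonneg_left hE (by linarith)
    linarith
  calc _ ≤ (p : ℝ) ^ m * (2 * (k - 1) *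
        (condExpect p (apEdges k N) (apTerms k) (Finset.Icc 1 m) -
        (1 + δ) * ((apEdges k N).card * (p : ℝ) ^ k))) :=
        mul_le_mul_of_nonneg_left h2 (by positivity)
    _ = 2 * (k - 1) * ((p : ℝ) ^ m * (condExpect p (apEdges k N) (apTerms k) (Finset.Icc 1 m) -
        (1 + δ) * ((apEdges k N).card * (p : ℝ) ^ k))) := by ring
    _ ≤ 2 * (k - 1) * ((apEdges k N).card * upperTailAP k N p δ) :=
        mul_le_mul_of_nonneg_left hI (by linarith)
    _ = (2 * (k - 1) * (apEdges k N).card) * upperTailAP k N p δ := by ring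
    _ ≤ N ^ 2 * upperTailAP k N p δ := mul_le_mul_of_nonneg_right hcard hU

end FiniteBounds

/-! ### Consequences of the two growth conditions on `p`. -/

section Regime

variable {k : ℕ} {p : ℕ → unitInterval}

lemma eventually_log_le (hp_lower : (fun N : ℕ => (N : ℝ)⁻¹ * Real.log (N : ℝ)) =o[atTop]
      fun N : ℕ => (p N : ℝ) ^ ((k : ℝ) / 2)) {ε : ℝ} (hε : 0 < ε) :
    ∀ᶠ N : ℕ in atTop, Real.log N ≤ ε * (N * (p N : ℝ) ^ ((k : ℝ) / 2)) := by
  filter_upwards [hp_lower.bound hε, eventually_ge_atTop 1] with N hN hN1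
  have hN0 : (0 : ℝ) < N := by exact_mod_cast hN1
  have hP : 0 ≤ (p N : ℝ) ^ ((k : ℝ) / 2) := Real.rpow_nonneg (p N).2.1 _
  rw [Real.norm_of_nonneg hP] at hN
  have h := (le_abs_self _).trans hN
  rw [inv_mul_le_iff₀ hN0] at h
  linarith

lemma tendsto_mean (hp_lower : (fun N : ℕ => (N : ℝ)⁻¹ * Real.log (N : ℝ)) =o[atTop]
      fun N : ℕ => (p N : ℝ) ^ ((k : ℝ) / 2)) :
    Tendsto (fun N : ℕ => (N : ℝ) * (p N : ℝ) ^ ((k : ℝ) / 2)) atTop atTop := by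
  have h := Real.tendsto_log_atTop.comp (tendsto_natCast_atTop_atTop (R := ℝ))
  refine tendsto_atTop_mono' _ ?_ h
  filter_upwards [eventually_log_le hp_lower one_pos] with N hN
  simpa using hN

lemma eventually_prob_pos (hk : 3 ≤ k)
    (hp_lower : (fun N : ℕ => (N : ℝ)⁻¹ * Real.log (N : ℝ)) =o[atTop]
      fun N : ℕ => (p N : ℝ) ^ ((k : ℝ) / 2)) : ∀ᶠ N : ℕ in atTop, 0 < (p N : ℝ) := by
  filter_upwards [(tendsto_mean hp_lower).eventually_gt_atTop 0] with N hN
  refine lt_of_le_of_ne (p N).2.1 fun h => ?_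
  rw [← h, Real.zero_rpow (by positivity)] at hN
  simp at hN

lemma tendsto_prob (hk : 3 ≤ k) (hp_upper : (fun N : ℕ => (p N : ℝ) ^ ((k : ℝ) / 2)) =o[atTop]
      fun _ : ℕ => (1 : ℝ)) : Tendsto (fun N => (p N : ℝ)) atTop (𝓝 0) := by
  rw [isLittleO_one_iff] at hp_upper
  have hk0 : (0 : ℝ) < k / 2 := by positivity
  have h := hp_upper.rpow_const (p := ((k : ℝ) / 2)⁻¹) (Or.inr (by positivity))
  rw [Real.zero_rpow (by positivity)] at h
  refine h.congr fun N => ?_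
  rw [← Real.rpow_mul (p N).2.1, mul_inv_cancel₀ hk0.ne', Real.rpow_one]

lemma tendsto_log_inv (hk : 3 ≤ k)
    (hp_lower : (fun N : ℕ => (N : ℝ)⁻¹ * Real.log (N : ℝ)) =o[atTop]
      fun N : ℕ => (p N : ℝ) ^ ((k : ℝ) / 2))
    (hp_upper : (fun N : ℕ => (p N : ℝ) ^ ((k : ℝ) / 2)) =o[atTop] fun _ : ℕ => (1 : ℝ)) :
    Tendsto (fun N => Real.log (1 / (p N : ℝ))) atTop atTop := by
  have h : Tendsto (fun N => (p N : ℝ)) atTop (𝓝[>] 0) :=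
    tendsto_nhdsWithin_iff.2 ⟨tendsto_prob hk hp_upper, eventually_prob_pos hk hp_lower⟩
  have h2 := tendsto_neg_atBot_atTop.comp (Real.tendsto_log_nhdsGT_zero.comp h)
  refine h2.congr fun N => ?_
  simp

/-- From `N p^(k/2) ≥ 1` and `k ≥ 3` it follows that `log (1/p) ≤ log N`, which is negligible
against `N p^(k/2)`. -/
lemma eventually_log_inv_le (hk : 3 ≤ k)
    (hp_lower : (fun N : ℕ => (N : ℝ)⁻¹ * Real.log (N : ℝ)) =o[atTop]
      fun N : ℕ => (p N : ℝ) ^ ((k : ℝ) / 2)) {ε : ℝ} (hε : 0 < ε) :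
    ∀ᶠ N : ℕ in atTop,
      Real.log (1 / (p N : ℝ)) ≤ ε * (N * (p N : ℝ) ^ ((k : ℝ) / 2)) := by
  filter_upwards [eventually_log_le hp_lower hε, (tendsto_mean hp_lower).eventually_ge_atTop 1,
    eventually_prob_pos hk hp_lower, eventually_ge_atTop 1] with N h1 h2 h3 h4
  refine le_trans ?_ h1
  have hN0 : (0 : ℝ) < N := by exact_mod_cast h4
  have h5 := Real.log_le_log one_pos h2
  rw [Real.log_one, Real.log_mul hN0.ne' (by positivity), Real.log_rpow h3] at h5
  rw [one_div, Real.log_inv]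
  have h6 : Real.log (p N) ≤ 0 := Real.log_nonpos h3.le (p N).2.2
  have h7 : (3 : ℝ) ≤ k := by exact_mod_cast hk
  nlinarith

lemma tendsto_sq_mul_exp_neg {b : ℝ} (hb : 0 < b) :
    Tendsto (fun x : ℝ => x ^ 2 * Real.exp (-b * x)) atTop (𝓝 0) := by
  have := tendsto_rpow_mul_exp_neg_mul_atTop_nhds_zero 2 b hb
  simpa using this

lemma eventually_log_add_two_le
    (hp_lower : (fun N : ℕ => (N : ℝ)⁻¹ * Real.log (N : ℝ)) =o[atTop]
      fun N : ℕ => (p N : ℝ) ^ ((k : ℝ) / 2)) {ε : ℝ} (hε : 0 < ε) :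
    ∀ᶠ N : ℕ in atTop, Real.log (N + 2) ≤ ε * (N * (p N : ℝ) ^ ((k : ℝ) / 2)) := by
  filter_upwards [eventually_log_le hp_lower (half_pos hε), eventually_ge_atTop 2] with N h1 h2
  have hN : (2 : ℝ) ≤ N := by exact_mod_cast h2
  have h3 : Real.log (N + 2) ≤ Real.log ((N : ℝ) ^ 2) :=
    Real.log_le_log (by positivity) (by nlinarith)
  rw [Real.log_pow] at h3
  push_cast at h3
  linarith

end Regime

/-! ### Choice of parameters for the two bounds. -/

section Asymptotics

lemma rpow_half_sq {x : ℝ} (hx : 0 ≤ x) (k : ℕ) : (x ^ ((k : ℝ) / 2)) ^ 2 = x ^ k := by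
  rw [← Real.rpow_natCast (x ^ ((k : ℝ) / 2)), ← Real.rpow_mul hx, ← Real.rpow_natCast x]
  congr 1
  push_cast
  ring

/-- An interval of length `⌈√(δ + ε) n⌉` is planted; the slack `ε` absorbs rounding, lower-order
counts and constants. Positivity of the tail is recorded because `Real.log 0 = 0`. -/
lemma eventually_neg_log_upperTailAP_le {k : ℕ} (hk : 3 ≤ k) {δ : ℝ} (hδ : 0 < δ)
    {p : ℕ → unitInterval}
    (hp_lower : (fun N : ℕ => (N : ℝ)⁻¹ * Real.log (N : ℝ)) =o[atTop]
      fun N : ℕ => (p N : ℝ) ^ ((k : ℝ) / 2))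
    (hp_upper : (fun N : ℕ => (p N : ℝ) ^ ((k : ℝ) / 2)) =o[atTop] fun _ : ℕ => (1 : ℝ))
    {ε : ℝ} (hε : 0 < ε) :
    ∀ᶠ N : ℕ in atTop, 0 < upperTailAP k N (p N) δ ∧
      -Real.log (upperTailAP k N (p N) δ) ≤ (Real.sqrt (δ + ε) + ε) *
        (N * (p N : ℝ) ^ ((k : ℝ) / 2) * Real.log (1 / (p N : ℝ))) := by
  set s := Real.sqrt (δ + ε) with hs
  have hs0 : 0 < s := Real.sqrt_pos.2 (by linarith)
  have hss : s ^ 2 = δ + ε := Real.sq_sqrt (by linarith)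
  have hkR : (3 : ℝ) ≤ k := by exact_mod_cast hk
  set η := ε / 4 / (δ + ε / 2) with hη
  have hη0 : 0 < η := by positivity
  have hP0 := tendsto_prob hk hp_upper
  have hPk : Tendsto (fun N => (p N : ℝ) ^ k) atTop (𝓝 0) := by
    have := hP0.pow k
    rwa [zero_pow (by omega)] at this
  have hPk2 : Tendsto (fun N => (p N : ℝ) ^ ((k : ℝ) / 2)) atTop (𝓝 0) :=
    (isLittleO_one_iff ℝ).1 hp_upper
  filter_upwards [eventually_prob_pos hk hp_lower, (tendsto_mean hp_lower).eventually_ge_atTop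
    (1 + 4 * k * (s + 1) / ε), (tendsto_log_inv hk hp_lower hp_upper).eventually_ge_atTop
    (1 + |2 * Real.log (4 / ε) / ε|), hPk.eventually_le_const hη0,
    hPk2.eventually_le_const (show 0 < 1 / (2 * s) by positivity), eventually_ge_atTop 2]
    with N hP hn hL hPη hPs hN2
  set P : ℝ := (p N : ℝ) with hPdef
  have hsq := rpow_half_sq hP.le k
  set w := P ^ ((k : ℝ) / 2) with hw
  set L := Real.log (1 / P) with hLdef
  set n : ℝ := N * w with hndef
  set U := upperTailAP k N (p N) δ with hU
  have hNR : (2 : ℝ) ≤ N := by exact_mod_cast hN2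
  have hn1 : 1 ≤ n := le_trans (le_add_of_nonneg_right (by positivity)) hn
  have hn2 : 4 * k * (s + 1) ≤ ε * n := by
    have : 4 * k * (s + 1) / ε ≤ n := by linarith
    rwa [div_le_iff₀' hε] at this
  have hL1 : 1 ≤ L := le_trans (le_add_of_nonneg_right (abs_nonneg _)) hL
  have hL2 : Real.log (4 / ε) ≤ ε / 2 * L := by
    have : 2 * Real.log (4 / ε) / ε ≤ L := by linarith [le_abs_self (2 * Real.log (4 / ε) / ε)]
    rw [div_le_iff₀' hε] at this
    linarith
  set m := ⌈s * n⌉₊ with hm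
  have hm1 : s * n ≤ m := Nat.le_ceil _
  have hm2 : (m : ℝ) < s * n + 1 := Nat.ceil_lt_add_one (by positivity)
  have hmN : m ≤ N := by
    rw [le_div_iff₀ (by positivity)] at hPs
    have h1 : s * n ≤ N / 2 := by
      have := mul_le_mul_of_nonneg_left hPs (Nat.cast_nonneg (α := ℝ) N)
      rw [hndef]
      linarith
    have h2 : (m : ℝ) ≤ N := by linarith
    exact_mod_cast h2
  have hplant := le_upperTailAP (by omega : 2 ≤ k) hmN (p := p N) hδ.le
  rw [← hPdef, ← hU] at hplant
  have hN2P : (N : ℝ) ^ 2 * P ^ k = n ^ 2 := by rw [hndef, mul_pow, hsq]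
  have h1 : (δ + ε / 2) * n ^ 2 ≤ (m : ℝ) ^ 2 - 2 * k * m := by
    have h2 : (s * n) ^ 2 ≤ (m : ℝ) ^ 2 := pow_le_pow_left₀ (by positivity) hm1 2
    rw [mul_pow, hss] at h2
    have h3 : 2 * k * (m : ℝ) ≤ 2 * k * ((s + 1) * n) := by
      refine mul_le_mul_of_nonneg_left ?_ (by positivity)
      linarith
    have h4 : 4 * k * (s + 1) * n ≤ ε * n * n := mul_le_mul_of_nonneg_right hn2 (by linarith)
    linarith
  have h2 : ε / 4 * n ^ 2 ≤ (m ^ 2 - 2 * k * m) * (1 - P ^ k) - δ * (N ^ 2 * P ^ k) := by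
    have h3 : 0 ≤ 1 - P ^ k := sub_nonneg.2 (pow_le_one₀ hP.le (p N).2.2)
    have h4 := mul_le_mul_of_nonneg_right h1 h3
    have h5 : (δ + ε / 2) * P ^ k ≤ ε / 4 := by
      rw [hη, le_div_iff₀ (by positivity)] at hPη
      linarith
    rw [hN2P]
    linarith [mul_le_mul_of_nonneg_right h5 (sq_nonneg n)]
  -- The gain `ε / 4 * n ^ 2` equals `ε / 4 * N ^ 2 * P ^ k`, so the factor `N ^ 2` cancels at the
  -- price of `P ^ k`, which costs only `k L`.
  have h3 : ε / 4 * P ^ (m + k) ≤ U := by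
    have h4 := (mul_le_mul_of_nonneg_left h2 (pow_nonneg hP.le m)).trans hplant
    rw [← hN2P] at h4
    have h5 : (N : ℝ) ^ 2 * (ε / 4 * P ^ (m + k)) ≤ N ^ 2 * U := by
      rw [pow_add]
      linarith
    exact le_of_mul_le_mul_left h5 (by positivity)
  have hU0 : 0 < U := lt_of_lt_of_le (by positivity) h3
  refine ⟨hU0, ?_⟩
  have h4 := Real.log_le_log (by positivity) h3
  have h5 : Real.log P = -L := by rw [hLdef, one_div, Real.log_inv, neg_neg]
  have h6 : Real.log (ε / 4) = -Real.log (4 / ε) := by rw [← Real.log_inv, inv_div]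
  rw [Real.log_mul (by positivity) (by positivity), Real.log_pow, h5, h6] at h4
  push_cast at h4
  have h7 : (m : ℝ) * L ≤ (s * n + 1) * L := mul_le_mul_of_nonneg_right hm2.le (by linarith)
  have h8 : (1 + (k : ℝ)) * L ≤ ε / 2 * n * L := by
    refine mul_le_mul_of_nonneg_right ?_ (by linarith)
    have : 0 < (k : ℝ) * s := by positivity
    linarith
  have h9 : ε / 2 * L ≤ ε / 2 * n * L := by
    have := mul_le_mul_of_nonneg_left hn1 (show 0 ≤ ε / 2 * L by positivity)
    linarith
  linarith

set_option maxHeartbeats 800000 in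
lemma eventually_upperTailAP_le {k : ℕ} (hk : 3 ≤ k) {δ : ℝ} (hδ : 0 < δ)
    {p : ℕ → unitInterval}
    (hp_lower : (fun N : ℕ => (N : ℝ)⁻¹ * Real.log (N : ℝ)) =o[atTop]
      fun N : ℕ => (p N : ℝ) ^ ((k : ℝ) / 2))
    (hp_upper : (fun N : ℕ => (p N : ℝ) ^ ((k : ℝ) / 2)) =o[atTop] fun _ : ℕ => (1 : ℝ))
    {ε : ℝ} (hε : 0 < ε) (hε1 : 4 * ε < 1) (hεδ : 4 * ε < δ) :
    ∀ᶠ N : ℕ in atTop, upperTailAP k N (p N) δ ≤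
      Real.exp (-(((1 - 4 * ε) * Real.sqrt (δ - 4 * ε) - ε) *
        (N * (p N : ℝ) ^ ((k : ℝ) / 2) * Real.log (1 / (p N : ℝ))))) := by
  set s := Real.sqrt (δ - 4 * ε) with hs
  have hs0 : 0 < s := Real.sqrt_pos.2 (by linarith)
  have hss : s ^ 2 = δ - 4 * ε := Real.sq_sqrt (by linarith)
  have hsδ : s ≤ Real.sqrt δ := Real.sqrt_le_sqrt (by linarith)
  have hkR : (3 : ℝ) ≤ k := by exact_mod_cast hk
  -- `ρ` is the ratio in the moment bound, and `C` makes `ρ ^ l ≤ exp (-√δ n L)` for `l = ⌈C n L⌉`.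
  -- The constant `c₀` limits the losses in core size, `A` is the least `t` for which fingerprints
  -- exist, and `C'` bounds the candidate count.
  set ρ := (1 + δ - ε) / (1 + δ) with hρ
  have hρ0 : 0 < ρ := div_pos (by linarith) (by linarith)
  have hρ1 : ρ < 1 := (div_lt_one (by linarith)).2 (by linarith)
  have hρl : Real.log ρ < 0 := Real.log_neg hρ0 hρ1
  set C := Real.sqrt δ / (-Real.log ρ) with hC
  have hC0 : 0 < C := div_pos (Real.sqrt_pos.2 hδ) (by linarith)
  set c₀ := ε / (6 * k ^ 2 * C) with hc₀
  have hc0 : 0 < c₀ := by positivity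
  set q := ε / (2 * k) with hq
  have hq0 : 0 < q := by positivity
  have hq1 : q ≤ 1 := (div_le_one (by positivity)).2 (by linarith)
  set A := 4 * k * (k : ℝ) ^ 2 / (q * q ^ (2 * (k - 1))) with hA
  have hA0 : 0 < A := by positivity
  set C' := 8 * (k : ℝ) ^ 4 * C / (q ^ (k - 1) * c₀) with hC'
  have hC'0 : 0 < C' := by positivity
  have hLtop := tendsto_log_inv hk hp_lower hp_upper
  filter_upwards [eventually_prob_pos hk hp_lower,
    (tendsto_mean hp_lower).eventually_ge_atTop (1 + 2 * k + 1 / C + k * δ / ε),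
    hLtop.eventually_ge_atTop (1 + 1 / (s * ε)),
    ((tendsto_sq_mul_exp_neg (b := 1 / 2) (by norm_num)).comp hLtop).eventually_le_const
      (show 0 < c₀ / (2 * (k + 2 * k ^ 3 * C)) by positivity),
    eventually_log_inv_le hk hp_lower (show 0 < c₀ / 2 / A by positivity),
    ((tendsto_sq_mul_exp_neg hε).comp hLtop).eventually_le_const (show 0 < ε / C' by positivity),
    eventually_log_add_two_le hp_lower hε]
    with N hP hn hL hLu hLn hLε hlogN
  simp only [Function.comp_apply] at hLu hLε
  set P : ℝ := (p N : ℝ) with hPdef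
  have hP1 : P ≤ 1 := (p N).2.2
  have hsq := rpow_half_sq hP.le k
  set w := P ^ ((k : ℝ) / 2) with hw
  have hw0 : 0 < w := Real.rpow_pos_of_pos hP _
  have hw1 : w ≤ 1 := Real.rpow_le_one hP.le hP1 (by positivity)
  set L := Real.log (1 / P) with hLdef
  have hlogP : Real.log P = -L := by rw [hLdef, one_div, Real.log_inv, neg_neg]
  have hPexp : P = Real.exp (-L) := by rw [← hlogP, Real.exp_log hP]
  set n : ℝ := N * w with hndef
  set E := apEdges k N with hE
  set W : ℝ := E.card * P ^ k with hW
  have hi1 : 0 < 1 / C := by positivity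
  have hi2 : 0 < k * δ / ε := by positivity
  have hi3 : 0 < 1 / (s * ε) := by positivity
  have hn1 : 1 ≤ n := by linarith
  have hL1 : 1 ≤ L := by linarith
  have hnL : n ≤ n * L := le_mul_of_one_le_right (by linarith) hL1
  have hCn : 1 ≤ C * n := by
    have : 1 / C ≤ n := by linarith
    rwa [div_le_iff₀' hC0] at this
  have hδn : k * δ ≤ ε * n := by
    have : k * δ / ε ≤ n := by linarith
    rwa [div_le_iff₀' hε] at this
  have hLs : 1 ≤ s * ε * L := by
    have : 1 / (s * ε) ≤ L := by linarith
    rwa [div_le_iff₀' (by positivity)] at this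
  have hN2P : (N : ℝ) ^ 2 * P ^ k = n ^ 2 := by rw [hndef, mul_pow, hsq]
  have hNP : (N : ℝ) * P ^ k ≤ n := by
    rw [hndef, ← hsq, sq]
    exact mul_le_mul_of_nonneg_left (mul_le_of_le_one_right hw0.le hw1) (Nat.cast_nonneg _)
  have hW2 : n ^ 2 - 2 * k * n ≤ 2 * (k - 1) * W := by
    have h1 := mul_le_mul_of_nonneg_right (le_card_apEdges (by omega : 2 ≤ k) N)
      (pow_nonneg hP.le k)
    rw [hN2P] at h1
    have h2 : 2 * k * ((N : ℝ) * P ^ k) ≤ 2 * k * n :=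
      mul_le_mul_of_nonneg_left hNP (by positivity)
    rw [hW]
    linarith
  have hW0 : 0 < W := by
    have h1 : 0 < n * (n - 2 * k) := mul_pos (by linarith) (by linarith)
    refine pos_of_mul_pos_right (a := 2 * ((k : ℝ) - 1)) ?_ (by linarith)
    linarith
  set l := ⌈C * (n * L)⌉₊ with hl
  have hl1 : C * (n * L) ≤ l := Nat.le_ceil _
  have hl2 : (l : ℝ) ≤ 2 * C * (n * L) := by
    have h1 := (Nat.ceil_lt_add_one (show 0 ≤ C * (n * L) by positivity)).le
    have h2 : C * n ≤ C * (n * L) := mul_le_mul_of_nonneg_left hnL hC0.le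
    linarith
  set t := c₀ * n / (2 * L) with ht
  have ht0 : 0 < t := by positivity
  -- With `u = √p`, `k ≥ 3` gives `p ^ (k - 1) ≤ p^(k/2) u`; both terms are then of order at most `n
  -- L u`, below `t = c₀ n / (2L)` because `L^2 u` tends to zero.
  have hR : k * N * P ^ (k - 1) + k ^ 2 * (k * l) * P ≤ t := by
    set u := Real.exp (-(1 / 2) * L) with hu
    have hu0 : 0 < u := Real.exp_pos _
    have hPu : P = u * u := by rw [hu, ← Real.exp_add, hPexp]; ring_nf
    have hu1 : u ≤ 1 := Real.exp_le_one_iff.2 (by linarith)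
    have hPlu : P ≤ u := hPu.trans_le (mul_le_of_le_one_right hu0.le hu1)
    have hwu : P ^ (k - 1) ≤ w * u := by
      rw [hw, hu, hPexp, ← Real.exp_nat_mul, ← Real.exp_mul, ← Real.exp_add]
      refine Real.exp_le_exp.2 ?_
      rw [Nat.cast_sub (by omega)]
      have := mul_nonneg (show 0 ≤ L by linarith) (show 0 ≤ (k : ℝ) - 3 by linarith)
      push_cast
      linarith
    have h1 : k * N * P ^ (k - 1) ≤ k * n * u := by
      rw [hndef, mul_assoc, mul_assoc, mul_assoc]
      gcongr
    have h2 : k ^ 2 * (k * l) * P ≤ k ^ 2 * (k * (2 * C * (n * L))) * u := by gcongr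
    have h3 : k * n * u + k ^ 2 * (k * (2 * C * (n * L))) * u ≤
        n * (u * L * (k + 2 * k ^ 3 * C)) := by
      have h4 : k * n * u ≤ k * n * u * L := le_mul_of_one_le_right (by positivity) hL1
      linarith
    rw [le_div_iff₀ (by positivity)] at hLu
    rw [ht, le_div_iff₀ (by positivity)]
    linarith [mul_le_mul_of_nonneg_right ((add_le_add h1 h2).trans h3)
      (show 0 ≤ 2 * L by positivity), mul_le_mul_of_nonneg_left hLu (show 0 ≤ n by positivity)]
  have htA : A ≤ t := by
    rw [ht, le_div_iff₀ (by positivity)]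
    rw [div_mul_eq_mul_div, le_div_iff₀ hA0] at hLn
    linarith
  have htq : 4 * k * (k : ℝ) ^ 2 / (t * q ^ (2 * (k - 1))) ≤ q := by
    rw [div_le_iff₀ (by positivity)]
    rw [hA, div_le_iff₀ (by positivity)] at htA
    linarith
  -- Of the `4 ε` lost from `δ`, one `ε` comes from the threshold `1 + δ - ε`, two from the linear
  -- error in `W`, and one from the three terms `k l t`.
  have hm₀ : (s * n) ^ 2 ≤ 2 * (k - 1) *
      ((1 + δ - ε) * W - k * l * (t + t) - E.card * P ^ k - k * l * t) := by
    have h1 : k * l * t ≤ k * (2 * C * (n * L)) * t := by gcongr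
    have h2 : k * (2 * C * (n * L)) * t = k * C * c₀ * n ^ 2 := by
      rw [ht]; field_simp
    have h3 : 6 * (k : ℝ) ^ 2 * C * c₀ = ε := by
      rw [hc₀]; field_simp
    rw [h2] at h1
    have h4 : 2 * ((k : ℝ) - 1) * (k * l * t) ≤ 2 * k * (k * C * c₀ * n ^ 2) := by
      have : 0 ≤ k * l * t := by positivity
      have h5 : 2 * ((k : ℝ) - 1) * (k * l * t) ≤ 2 * k * (k * l * t) := by linarith
      exact h5.trans (mul_le_mul_of_nonneg_left h1 (by positivity))
    have h5 : 3 * (2 * k * (k * C * c₀ * n ^ 2)) = ε * n ^ 2 := by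
      rw [← h3]; ring
    have h6 : (δ - ε) * (n ^ 2 - 2 * k * n) ≤ (δ - ε) * (2 * (k - 1) * W) :=
      mul_le_mul_of_nonneg_left hW2 (by linarith)
    have h7 : k * δ * n ≤ ε * n * n := mul_le_mul_of_nonneg_right hδn (by linarith)
    have h8 : 0 ≤ ε * (2 * k * n) := by positivity
    rw [mul_pow, hss, ← hW]
    linarith
  have hcx : (1 + δ - ε) * W / ((1 + δ) * W) = ρ := by
    rw [hρ, mul_div_mul_right _ _ hW0.ne']
  set b := Real.exp (-((1 - 4 * ε) * s * (n * L))) with hb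
  -- With `y₁ = p^(-k)`, `y₂ = p^(-ε)` and `q = ε / (2k)`, each of the four counting factors is at
  -- most `exp (ε L m)`, leaving `exp (-(1 - 4ε) L m)`.
  have hmain := upperTailAP_le hk (N := N) (l := l) (p := p N) (δ := δ)
    (c := (1 + δ - ε) * W) (τ := t + t) (t := t) (R := t) (q := q) (y₁ := Real.exp (k * L))
    (y₂ := Real.exp (ε * L)) (m₀ := s * n) (b := b) (mul_pos (by linarith) hW0)
    (mul_nonneg (by linarith) hW0.le) ht0 hR le_rfl hq0 hq1 htq
    (Real.one_le_exp (by positivity)) (Real.one_le_exp (by positivity)) hm₀ (Real.exp_pos _).le (by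
      intro m hm1 hm2
      have hm3 : (m : ℝ) ≤ k * (2 * C * (n * L)) := by
        have : (m : ℝ) ≤ k * l := by exact_mod_cast hm2
        exact this.trans (mul_le_mul_of_nonneg_left hl2 (by positivity))
      rw [← hPdef, hPexp, ← Real.exp_mul, ← Real.exp_mul, ← Real.exp_nat_mul, ← Real.exp_add,
        ← Real.exp_add, ← Real.exp_add, ← Real.exp_add, hb]
      refine Real.exp_le_exp.2 ?_
      have e1 : k * L * (2 * q * m) = ε * (L * m) := by
        rw [hq]; field_simp
      have e2 : N / Real.exp (k * L) ≤ ε * (L * m) := by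
        have h1 : N / Real.exp (k * L) = N * P ^ k := by
          rw [hPexp, ← Real.exp_nat_mul, div_eq_mul_inv, ← Real.exp_neg]
          ring_nf
        rw [h1]
        refine hNP.trans ?_
        have h2 : n * 1 ≤ n * (s * ε * L) := mul_le_mul_of_nonneg_left hLs (by linarith)
        have h3 : ε * L * (s * n) ≤ ε * L * m := mul_le_mul_of_nonneg_left hm1 (by positivity)
        linarith
      have e3 : 2 * k * (k : ℝ) ^ 2 * m ^ 2 / (q ^ (k - 1) * t) / Real.exp (ε * L) ≤
          ε * (L * m) := by
        have h1 : 2 * k * (k : ℝ) ^ 2 * m ^ 2 / (q ^ (k - 1) * t) ≤ m * (C' * L ^ 2) := by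
          calc 2 * k * (k : ℝ) ^ 2 * m ^ 2 / (q ^ (k - 1) * t)
              = m * (2 * k ^ 3 * m / (q ^ (k - 1) * t)) := by ring
            _ ≤ m * (2 * k ^ 3 * (k * (2 * C * (n * L))) / (q ^ (k - 1) * t)) := by gcongr
            _ = m * (C' * L ^ 2) := by
                rw [hC', ht]; field_simp; ring
        have h2 : C' * (L ^ 2 * Real.exp (-ε * L)) ≤ ε := by
          rwa [le_div_iff₀' hC'0] at hLε
        rw [div_eq_mul_inv, ← Real.exp_neg, ← neg_mul]
        calc _ ≤ m * (C' * L ^ 2) * Real.exp (-ε * L) :=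
              mul_le_mul_of_nonneg_right h1 (Real.exp_pos _).le
          _ = m * (C' * (L ^ 2 * Real.exp (-ε * L))) := by ring
          _ ≤ m * ε := mul_le_mul_of_nonneg_left h2 (Nat.cast_nonneg _)
          _ ≤ ε * (L * m) := by
              have : (m : ℝ) * ε ≤ m * ε * L := le_mul_of_one_le_right (by positivity) hL1
              linarith
      have e4 : (1 - 4 * ε) * L * (s * n) ≤ (1 - 4 * ε) * L * m :=
        mul_le_mul_of_nonneg_left hm1 (mul_nonneg (by linarith) (by linarith))
      linarith)
  rw [← hPdef, ← hE, ← hW, hcx] at hmain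
  have hρb : ρ ^ l ≤ b := by
    rw [← Real.exp_log hρ0, ← Real.exp_nat_mul, hb]
    refine Real.exp_le_exp.2 ?_
    have h1 : Real.sqrt δ * (n * L) = C * (n * L) * (-Real.log ρ) := by
      have : C * (-Real.log ρ) = Real.sqrt δ := div_mul_cancel₀ _ (neg_pos.2 hρl).ne'
      rw [← this]
      ring
    have h2 : C * (n * L) * (-Real.log ρ) ≤ l * (-Real.log ρ) :=
      mul_le_mul_of_nonneg_right hl1 (by linarith)
    have h3 : (1 - 4 * ε) * s * (n * L) ≤ Real.sqrt δ * (n * L) := by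
      refine mul_le_mul_of_nonneg_right ?_ (by positivity)
      have := mul_pos hε hs0
      linarith
    linarith
  refine hmain.trans ((add_le_add_left hρb _).trans ?_)
  have h1 : b + (N + 1) * b = Real.exp (Real.log (N + 2)) * b := by
    rw [Real.exp_log (by positivity)]
    ring
  rw [h1, hb, ← Real.exp_add]
  refine Real.exp_le_exp.2 ?_
  have h2 : ε * n ≤ ε * (n * L) := mul_le_mul_of_nonneg_left hnL hε.le
  linarith

end Asymptotics

theorem theorem1p3 (k : ℕ) (hk : 3 ≤ k) (δ : ℝ) (hδ : 0 < δ) (p : ℕ → unitInterval)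
    (hp_lower : (fun N : ℕ => (N : ℝ)⁻¹ * Real.log (N : ℝ)) =o[atTop]
      fun N : ℕ => (p N : ℝ) ^ ((k : ℝ) / 2))
    (hp_upper : (fun N : ℕ => (p N : ℝ) ^ ((k : ℝ) / 2)) =o[atTop] fun _ : ℕ => (1 : ℝ)) :
    Tendsto
      (fun N : ℕ => -Real.log (upperTailAP k N (p N) δ) /
        ((N : ℝ) * (p N : ℝ) ^ ((k : ℝ) / 2) * Real.log (1 / (p N : ℝ))))
      atTop (𝓝 (Real.sqrt δ)) := by
  have hden : ∀ᶠ N : ℕ in atTop,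
      0 < (N : ℝ) * (p N : ℝ) ^ ((k : ℝ) / 2) * Real.log (1 / (p N : ℝ)) := by
    filter_upwards [(tendsto_mean hp_lower).eventually_gt_atTop 0,
      (tendsto_log_inv hk hp_lower hp_upper).eventually_gt_atTop 0] with N h1 h2
    exact mul_pos h1 h2
  refine tendsto_order.2 ⟨fun a ha => ?_, fun a ha => ?_⟩
  · have hcont : Tendsto (fun ε : ℝ => (1 - 4 * ε) * Real.sqrt (δ - 4 * ε) - ε) (𝓝[>] 0)
        (𝓝 (Real.sqrt δ)) := by
      have h : Continuous fun ε : ℝ => (1 - 4 * ε) * Real.sqrt (δ - 4 * ε) - ε := by fun_prop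
      have h2 := h.tendsto 0
      simp only [mul_zero, sub_zero, one_mul] at h2
      exact h2.mono_left nhdsWithin_le_nhds
    have hsmall : ∀ᶠ ε : ℝ in 𝓝[>] 0, ε < min (1 / 4) (δ / 4) :=
      nhdsWithin_le_nhds (eventually_lt_nhds (by positivity))
    obtain ⟨ε, hε1, hε2, hε0⟩ := ((hcont.eventually_const_lt ha).and
      (hsmall.and self_mem_nhdsWithin)).exists
    rw [lt_min_iff] at hε2
    filter_upwards [eventually_upperTailAP_le hk hδ hp_lower hp_upper hε0 (by linarith [hε2.1])
      (by linarith [hε2.2]), hden,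
      eventually_neg_log_upperTailAP_le hk hδ hp_lower hp_upper one_pos] with N h1 h2 h3
    rw [lt_div_iff₀ h2]
    -- Only positivity of the tail is taken from the planting bound here: the logarithm is monotone
    -- on positive arguments.
    have h4 := Real.log_le_log h3.1 h1
    rw [Real.log_exp] at h4
    refine (mul_lt_mul_of_pos_right hε1 h2).trans_le ?_
    linarith
  · have hcont : Tendsto (fun ε : ℝ => Real.sqrt (δ + ε) + ε) (𝓝[>] 0) (𝓝 (Real.sqrt δ)) := by
      have h : Continuous fun ε : ℝ => Real.sqrt (δ + ε) + ε := by fun_prop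
      have h2 := h.tendsto 0
      simp only [add_zero] at h2
      exact h2.mono_left nhdsWithin_le_nhds
    obtain ⟨ε, hε1, hε0⟩ := ((hcont.eventually_lt_const ha).and self_mem_nhdsWithin).exists
    filter_upwards [eventually_neg_log_upperTailAP_le hk hδ hp_lower hp_upper hε0, hden]
      with N h1 h2
    rw [div_lt_iff₀ h2]
    exact h1.2.trans_lt (mul_lt_mul_of_pos_right hε1 h2)
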